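/- Let $n,m\ge 1$, let $a\in\mathcal S_n$, $b\in\mathcal S_m$ be points of the unit simplices, let $C\in\mathbb R_+^{n\times m}$ have largest entry $\|C\|_\infty$, let $\varepsilon>0$, and put $\gamma=\varepsilon/3$, $N=n+m$. Let $X^*$ be a minimiser of $\langle C,X\rangle$ over the transport plans, i.e. over $X\in\mathbb R_+^{n\times m}$ with $X\mathbf 1_m=a$, $X^\top\mathbf 1_n=b$. Let $$f(X)=\langle C,X\rangle+\tfrac{\gamma}{2}\|X\|_2^2,\qquad \varphi(\lambda,\mu)=-\tfrac1{2\gamma}\sum_{i,j}[-c_{ij}-\lambda_i-\mu_j]_+^2-\lambda^\top a-\mu^\top b .$$ *Coordinate Linear Variance Reduction* with parameter $\alpha>0$, at most $K\ge1$ iterations and residual tolerance $\delta\in\mathbb R$: let $\xi_0,\xi_1,\dots$ be independent and uniform on $[0,1]$. Put $a_0=A_0=\frac1{2\sqrt N}$, let $X_0$ be the $n\times m$ matrix with all entries $\frac1{nm}$, and put $\lambda_0=0$, $\mu_0=0$, $z_{-1}=0$, $q_{-1}=a_0C$. For $k=0,1,\dots,K-1$ put $$A_{k+1}=A_k+a_k,\qquad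 X_{k+1}=\frac{[\alpha X_0-q_{k-1}]_+}{\alpha+\gamma A_{k+1}};$$ if $\xi_k<\frac12$, put $\lambda_{k+1}=\lambda_k+2\gamma a_k(X_{k+1}\mathbf 1_m-a)$, $\mu_{k+1}=\mu_k$, $z_k=z_{k-1}+(\lambda_{k+1}-\lambda_k)\mathbf 1_m^\top$; otherwise put $\lambda_{k+1}=\lambda_k$, $\mu_{k+1}=\mu_k+2\gamma a_k(X_{k+1}^\top\mathbf 1_n-b)$, $z_k=z_{k-1}+\mathbf 1_n(\mu_{k+1}-\mu_k)^\top$; then put $$a_{k+1}=\tfrac14\sqrt{\tfrac{1+\gamma A_k/\alpha}{N}},\qquad q_k=q_{k-1}+a_{k+1}(z_k+C)+2a_k(z_k-z_{k-1}),\qquad \widetilde X_{k+1}=\frac1{A_{k+1}}\sum_{i=1}^{k+1}a_iX_i,$$ and stop if $f(\widetilde X_{k+1})-\varphi(\lambda_{k+1},\mu_{k+1})\le\varepsilon/3$ and $\big(\|\widetilde X_{k+1}\mathbf 1_m-a\|_2^2+\|\widetilde X_{k+1}^\top\mathbf 1_n-b\|_2^2\big)^{1/2}\le\delta$. Let $X'$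 be the last $\widetilde X_{k+1}$ computed. The returned plan $X$ is obtained from $X'$ by the rounding procedure of Altschuler, Weed and Rigollet: multiply each row whose sum exceeds the corresponding $a_i$ by the factor that makes its sum $a_i$, then do the same for columns and $b$; if $F$ is the result, $r=a-F\mathbf 1_m$ and $s=b-F^\top\mathbf 1_n$, return $X=F+rs^\top/\|r\|_1$ (and $X=F$ if $r=0$). **Theorem.** There is an absolute constant $c>0$ such that for all $n,m,C,\varepsilon$ as above there is a parameter $\alpha>0$ (depending only on $n,m,C,\varepsilon$) with the following property. Let $a,b$ be as above, let $\delta$ be any residual tolerance with $2\sqrt{n+m}\,\|C\|_\infty\,\delta\le\varepsilon/3$ (for $\delta<0$ the method always performs $K$ iterations), and let $K\ge1$ be any integer with $$K\ \ge\ c\,\min\Big\{\frac{(n+m)^{3/2}\|C\|_\infty^2}{\varepsilon^2},\ \frac{(n+m)\|C\|_\infty}{\varepsilon}\Big\}.$$ Then the returned plan always satisfies $X\mathbf 1_m=a$, $X^\top\mathbf 1_n=b$, $X\ge0$ exactly, and it is $\varepsilon$-optimal in expectation: $$\mathbb E[\langle C,X\rangle]-\varepsilon\le\langle C,X^*\rangle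 .$$ Thus $\mathcal O\big(\min\{(n+m)^{3/2}\|C\|_\infty^2/\varepsilon^2,\ (n+m)\|C\|_\infty/\varepsilon\}\big)$ iterations suffice (at least one being performed). -/

import Mathlib

open MeasureTheory ProbabilityTheory

noncomputable section

namespace EuclideanOT

variable {n m : ℕ}

/-- The linear transport cost `⟨C, X⟩`. -/
def cost (C X : Matrix (Fin n) (Fin m) ℝ) : ℝ := ∑ i, ∑ j, C i j * X i j

/-- `‖C‖_∞`, the largest absolute value of an entry. -/
def supNorm (C : Matrix (Fin n) (Fin m) ℝ) : ℝ := ⨆ p : Fin n × Fin m, |C p.1 p.2|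

/-- Row marginal `X 1_m`. -/
def rowSum (X : Matrix (Fin n) (Fin m) ℝ) : Fin n → ℝ := fun i => ∑ j, X i j

/-- Column marginal `Xᵀ 1_n`. -/
def colSum (X : Matrix (Fin n) (Fin m) ℝ) : Fin m → ℝ := fun j => ∑ i, X i j

/-- The transport plans between `a` and `b`: nonnegative matrices with marginals `a` and `b`. -/
def plans (a : Fin n → ℝ) (b : Fin m → ℝ) : Set (Matrix (Fin n) (Fin m) ℝ) :=
  {X | (∀ i j, 0 ≤ X i j) ∧ rowSum X = a ∧ colSum X = b}

/-- `X` solves the (unregularised) optimal transport problem. -/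
def IsOptimalPlan (C : Matrix (Fin n) (Fin m) ℝ) (a : Fin n → ℝ) (b : Fin m → ℝ)
    (X : Matrix (Fin n) (Fin m) ℝ) : Prop :=
  X ∈ plans a b ∧ IsMinOn (cost C) (plans a b) X

/-- The Euclidean-regularised objective `f(X) = ⟨C, X⟩ + (γ/2) ‖X‖₂²`. -/
def regCost (γ : ℝ) (C X : Matrix (Fin n) (Fin m) ℝ) : ℝ :=
  cost C X + γ / 2 * ∑ i, ∑ j, X i j ^ 2

/-- The dual objective
`φ(λ, μ) = -(1/(2γ)) ∑ᵢⱼ [-cᵢⱼ - λᵢ - μⱼ]₊² - λᵀ a - μᵀ b`. -/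
def dual (γ : ℝ) (C : Matrix (Fin n) (Fin m) ℝ) (a : Fin n → ℝ) (b : Fin m → ℝ)
    (lam : Fin n → ℝ) (mu : Fin m → ℝ) : ℝ :=
  -(1 / (2 * γ)) * (∑ j, ∑ i, (max 0 (-C i j - lam i - mu j)) ^ 2)
    - (∑ i, lam i * a i) - ∑ j, mu j * b j

/-- The Euclidean norm `‖(X 1_m - a, Xᵀ 1_n - b)‖₂` of the violation of the constraints. -/
def residual (a : Fin n → ℝ) (b : Fin m → ℝ) (X : Matrix (Fin n) (Fin m) ℝ) : ℝ :=
  Real.sqrt ((∑ i, (rowSum X i - a i) ^ 2) + ∑ j, (colSum X j - b j) ^ 2)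

/-! ### Rounding to the transport polytope -/

/-- Scale down the rows whose sum exceeds the target. -/
def scaleRows (a : Fin n → ℝ) (F : Matrix (Fin n) (Fin m) ℝ) : Matrix (Fin n) (Fin m) ℝ :=
  fun i j => if a i < rowSum F i then a i / rowSum F i * F i j else F i j

/-- Scale down the columns whose sum exceeds the target. -/
def scaleCols (b : Fin m → ℝ) (F : Matrix (Fin n) (Fin m) ℝ) : Matrix (Fin n) (Fin m) ℝ :=
  fun i j => if b j < colSum F j then b j / colSum F j * F i j else F i j

/-- The rounding procedure of Altschuler, Weed and Rigollet: scale down rows, then columns, then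
add the rank-one matrix `err_a err_bᵀ / ‖err_a‖₁` built from the missing marginal masses (nothing
is added if no mass is missing, as then `err_a = 0`). -/
def roundPlan (a : Fin n → ℝ) (b : Fin m → ℝ) (F : Matrix (Fin n) (Fin m) ℝ) :
    Matrix (Fin n) (Fin m) ℝ :=
  let G := scaleCols b (scaleRows a F)
  fun i j => G i j +
    (a i - rowSum G i) * (b j - colSum G j) / ∑ i', |a i' - rowSum G i'|

/-! ### Coordinate Linear Variance Reduction -/

/-- The data held after `k` iterations: the step size `a_k`, the weight `A_k`, the dual variables
`λ_k` and `μ_k`, the matrices `z_{k-1}` and `q_{k-1}`, and the sum `∑_{i=1}^{k} a_i X_i`. -/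
structure CLVRState (n m : ℕ) where
  step : ℝ
  weight : ℝ
  lam : Fin n → ℝ
  mu : Fin m → ℝ
  z : Matrix (Fin n) (Fin m) ℝ
  q : Matrix (Fin n) (Fin m) ℝ
  sumX : Matrix (Fin n) (Fin m) ℝ

/-- Initialisation: `a_0 = A_0 = 1/(2√(n+m))`, `λ_0 = 0`, `μ_0 = 0`, `z_{-1} = 0`,
`q_{-1} = a_0 C`. -/
def clvrInit (C : Matrix (Fin n) (Fin m) ℝ) : CLVRState n m where
  step := 1 / (2 * Real.sqrt ((n : ℝ) + m))
  weight := 1 / (2 * Real.sqrt ((n : ℝ) + m))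
  lam := 0
  mu := 0
  z := 0
  q := (1 / (2 * Real.sqrt ((n : ℝ) + m))) • C
  sumX := 0

/-- The primal iterate `X_{k+1} = [α X_0 - q_{k-1}]₊ / (α + γ A_{k+1})`, where `X_0` is the matrix
with all entries `1/(nm)` and `A_{k+1} = A_k + a_k`. -/
def clvrPrimal (α γ : ℝ) (S : CLVRState n m) : Matrix (Fin n) (Fin m) ℝ :=
  fun i j => max 0 (α * (1 / ((n : ℝ) * m)) - S.q i j) / (α + γ * (S.weight + S.step))

/-- One iteration, with the random number `ξ_k`. -/
def clvrStep (α γ : ℝ) (C : Matrix (Fin n) (Fin m) ℝ) (a : Fin n → ℝ) (b : Fin m → ℝ)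
    (ξ : ℝ) (S : CLVRState n m) : CLVRState n m :=
  let X := clvrPrimal α γ S
  let lam' : Fin n → ℝ := fun i =>
    if ξ < 1 / 2 then S.lam i + 2 * γ * S.step * (rowSum X i - a i) else S.lam i
  let mu' : Fin m → ℝ := fun j =>
    if ξ < 1 / 2 then S.mu j else S.mu j + 2 * γ * S.step * (colSum X j - b j)
  let step' : ℝ := 1 / 4 * Real.sqrt ((1 + γ * S.weight / α) / ((n : ℝ) + m))
  let z' : Matrix (Fin n) (Fin m) ℝ := fun i j =>
    if ξ < 1 / 2 then S.z i j + (lam' i - S.lam i) else S.z i j + (mu' j - S.mu j)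
  { step := step'
    weight := S.weight + S.step
    lam := lam'
    mu := mu'
    z := z'
    q := S.q + step' • (z' + C) + (2 * S.step) • (z' - S.z)
    sumX := S.sumX + step' • X }

/-- The state after `k` iterations driven by the sequence `ξ_0, ξ_1, …`. -/
def clvrState (α γ : ℝ) (C : Matrix (Fin n) (Fin m) ℝ) (a : Fin n → ℝ) (b : Fin m → ℝ)
    (ξ : ℕ → ℝ) : ℕ → CLVRState n m
  | 0 => clvrInit C
  | k + 1 => clvrStep α γ C a b (ξ k) (clvrState α γ C a b ξ k)

/-- The averaged iterate `X̃_k = (1/A_k) ∑_{i=1}^{k} a_i X_i` of a state. -/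
def CLVRState.avg (S : CLVRState n m) : Matrix (Fin n) (Fin m) ℝ := (1 / S.weight) • S.sumX

/-- The stopping test with gap tolerance `η` and residual tolerance `δ`:
`f(X̃) - φ(λ, μ) ≤ η` and `‖(X̃ 1_m - a, X̃ᵀ 1_n - b)‖₂ ≤ δ`. -/
def stopTest (γ η δ : ℝ) (C : Matrix (Fin n) (Fin m) ℝ) (a : Fin n → ℝ) (b : Fin m → ℝ)
    (S : CLVRState n m) : Prop :=
  regCost γ C S.avg - dual γ C a b S.lam S.mu ≤ η ∧ residual a b S.avg ≤ δ

/-- The number of iterations performed when at most `K ≥ 1` are allowed: the loop ends after the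
first iteration whose result passes the stopping test, and after `K` iterations at the latest. -/
def clvrStop (α γ η δ : ℝ) (K : ℕ) (C : Matrix (Fin n) (Fin m) ℝ) (a : Fin n → ℝ)
    (b : Fin m → ℝ) (ξ : ℕ → ℝ) : ℕ :=
  sInf {k : ℕ | 1 ≤ k ∧ (stopTest γ η δ C a b (clvrState α γ C a b ξ k) ∨ K ≤ k)}

/-- The whole procedure: run the method with `γ = ε/3`, gap tolerance `ε/3` and residual
tolerance `δ` for at most `K` iterations, and round the averaged iterate to a transport plan. -/
def approxOT (α ε δ : ℝ) (K : ℕ) (C : Matrix (Fin n) (Fin m) ℝ) (a : Fin n → ℝ)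
    (b : Fin m → ℝ) (ξ : ℕ → ℝ) : Matrix (Fin n) (Fin m) ℝ :=
  roundPlan a b
    (clvrState α (ε / 3) C a b ξ (clvrStop α (ε / 3) (ε / 3) δ K C a b ξ)).avg

end EuclideanOT

end

/-! Take `α = γ = ε/3`. If `ε ≥ ‖C‖_∞`, every plan costs at most `ε`, and feasibility after rounding
is enough. If `ε ≤ ‖C‖_∞`, the minimum in the bound is `N‖C‖_∞/ε`, so this is the only rate to
prove.

The method is dual averaging in the primal variable and randomised block ascent in the dual one.
Write `x_k` for `X_{k+1}`, `𝒜` for the marginal map, `v_k = γ a_k 𝒜(x_k - X*)` and `Δ_k = y_{k+1} -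
y_k`. With the reflection `J` that negates the `λ` block and a random sign `s_k`, one has `Δ_k = v_k
- s_k J v_k`, an unbiased estimate of `v_k`. Two facts hold on every path. Strong convexity of the
proximal objective pays for the error of extrapolation and gives `∑ a_i (f(x_i) - f(X*) + ⟨y_i,
𝒜(x_i - X*)⟩) + 3/(4γ) ∑ ‖Δ_i‖² ≤ 2γ` (`sum_lagrangian_le`). For any `R ≥ 0`, Young's inequality
bounds `γ R ‖∑ a_i 𝒜(x_i - X*)‖` by `R² + ‖y‖²/2 + ‖∑ v_i - y‖²/2`; expanding the squares produces
`(3/4) ∑ ‖Δ_i‖²`, the coupling terms `γ ∑ a_i ⟨y_i, 𝒜(x_i - X*)⟩` and a martingale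
(`sum_signed_noise`). Hence gap plus `R` times residual is at most `2γ + R²/γ` plus mean-zero noise
(`gap_add_residual_le`). No bound on a dual solution is needed.

The averaged iterate weights `x_i` by `a_{i+1}` instead of `a_i`. Since `a_{i+1}/a_i` is bounded and
eventually decreasing (`stepRatio_succ_le`), Abel summation transfers the bound at the price of a
constant (`reweighted_le`).

Rounding costs at most `√N ‖C‖_∞` times the residual, so `R` is this factor. As `A_K ≥ K²/(1024 N)`,
the error `R²/(γ A_K)` is of order `N²‖C‖_∞²/(ε K²)`, which gives the rate (`error_le`). Early
stopping needs no stopping-time argument: by weak duality a plan accepted by the test is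
`2ε/3`-optimal, so on every path it is compared with the plan obtained after all `K` iterations
(`cost_approxOT_le`). -/

noncomputable section

namespace EuclideanOT

/-! ### Pathwise analysis of an abstract two-block primal-dual method -/

section Abstract

open scoped InnerProductSpace
open Finset

variable {E H : Type*} [NormedAddCommGroup E] [InnerProductSpace ℝ E]
  [NormedAddCommGroup H] [InnerProductSpace ℝ H]

/-- The regularised linear objective `⟨c, u⟩ + (γ/2) ‖u‖²`. -/
def regObj (γ : ℝ) (c u : E) : ℝ := ⟪c, u⟫_ℝ + γ / 2 * ‖u‖ ^ 2

/-- The function minimised by the primal iterate of a dual averaging method. -/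
def proxObj (γ B : ℝ) (q x₀ u : E) : ℝ :=
  ⟪q, u⟫_ℝ + γ * B / 2 * ‖u‖ ^ 2 + γ / 2 * ‖u - x₀‖ ^ 2

/-- One path of a two-block primal-dual coordinate method for the minimisation of `regObj γ c`
subject to `A u = A xs`. The blocks are the eigenspaces of the reflection `J`, and the signs `s k`
select the block that is updated. -/
structure CoordinateRun (A : E →ₗ[ℝ] H) (J : H →ₗ[ℝ] H) (c x₀ xs : E) (γ N : ℝ)
    (a s : ℕ → ℝ) (x q : ℕ → E) (y : ℕ → H) : Prop where
  γ_pos : 0 < γ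
  N_nonneg : 0 ≤ N
  J_symm : ∀ u v, ⟪J u, v⟫_ℝ = ⟪u, J v⟫_ℝ
  J_invol : ∀ u, J (J u) = u
  sign : ∀ k, s k = 1 ∨ s k = -1
  block_bound : ∀ k u, ‖A u - s k • J (A u)‖ ≤ 2 * Real.sqrt N * ‖u‖
  a_pos : ∀ k, 0 < a k
  a_zero_le : a 0 ≤ 1
  a_zero_sq : 4 * N * a 0 ^ 2 ≤ 1
  a_succ_sq : ∀ k, 16 * N * a (k + 1) ^ 2 ≤ 1 + (a 0 + ∑ i ∈ range (k + 2), a i)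
  xs_norm : ‖xs‖ ^ 2 ≤ 1
  xs_sub : ‖xs - x₀‖ ^ 2 ≤ 2
  x_zero : ‖x 0 - xs‖ ^ 2 ≤ 2
  y_zero : y 0 = 0
  y_succ : ∀ k, y (k + 1) = y k + ((γ * a k) • A (x k - xs) - s k • J ((γ * a k) • A (x k - xs)))
  q_zero : q 0 = a 0 • c
  q_succ : ∀ k u, ⟪q (k + 1), u⟫_ℝ = ⟪q k, u⟫_ℝ + a (k + 1) * (⟪y (k + 1), A u⟫_ℝ + ⟪c, u⟫_ℝ)
    + 2 * a k * ⟪y (k + 1) - y k, A u⟫_ℝ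
  opt_xs : ∀ k, proxObj γ (a 0 + ∑ i ∈ range (k + 1), a i) (q k) x₀ (x k)
    + γ * (1 + (a 0 + ∑ i ∈ range (k + 1), a i)) / 2 * ‖xs - x k‖ ^ 2
    ≤ proxObj γ (a 0 + ∑ i ∈ range (k + 1), a i) (q k) x₀ xs
  opt_succ : ∀ k, proxObj γ (a 0 + ∑ i ∈ range (k + 1), a i) (q k) x₀ (x k)
    + γ * (1 + (a 0 + ∑ i ∈ range (k + 1), a i)) / 2 * ‖x (k + 1) - x k‖ ^ 2
    ≤ proxObj γ (a 0 + ∑ i ∈ range (k + 1), a i) (q k) x₀ (x (k + 1))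

namespace CoordinateRun

variable {A : E →ₗ[ℝ] H} {J : H →ₗ[ℝ] H} {c x₀ xs : E} {γ N : ℝ} {a s : ℕ → ℝ}
  {x q : ℕ → E} {y : ℕ → H}

lemma sign_mul_self (h : CoordinateRun A J c x₀ xs γ N a s x q y) (k : ℕ) : s k * s k = 1 := by
  rcases h.sign k with h | h <;> rw [h] <;> norm_num

lemma sum_nonneg (h : CoordinateRun A J c x₀ xs γ N a s x q y) (k : ℕ) :
    0 ≤ ∑ i ∈ range k, a i :=
  Finset.sum_nonneg fun i _ => (h.a_pos i).le

lemma J_inner_J (h : CoordinateRun A J c x₀ xs γ N a s x q y) (u v : H) :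
    ⟪J u, J v⟫_ℝ = ⟪u, v⟫_ℝ := by
  rw [h.J_symm, h.J_invol]

lemma norm_sub_sign_J_sq (h : CoordinateRun A J c x₀ xs γ N a s x q y) (k : ℕ) (v : H) :
    ‖v - s k • J v‖ ^ 2 = 2 * ‖v‖ ^ 2 - 2 * s k * ⟪v, J v⟫_ℝ := by
  have h1 := h.sign_mul_self k
  rw [norm_sub_sq_real, norm_smul, inner_smul_right, mul_pow, Real.norm_eq_abs, sq_abs,
    ← real_inner_self_eq_norm_sq (J v), h.J_inner_J, real_inner_self_eq_norm_sq]
  linear_combination ‖v‖ ^ 2 * h1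

lemma inner_sub_sign_J_self (h : CoordinateRun A J c x₀ xs γ N a s x q y) (k : ℕ) (v : H) :
    2 * ⟪v - s k • J v, v⟫_ℝ = ‖v - s k • J v‖ ^ 2 := by
  rw [h.norm_sub_sign_J_sq, inner_sub_left, inner_smul_left, real_inner_self_eq_norm_sq, h.J_symm]
  simp
  ring

/-- The operator `1 - s J` is twice an orthogonal projection, so only the selected block of `A u`
enters the inner product, and `block_bound` applies to that block. -/
lemma abs_inner_block_le (h : CoordinateRun A J c x₀ xs γ N a s x q y) (k : ℕ) (v : H) (u : E) :
    |⟪v - s k • J v, A u⟫_ℝ| ≤ ‖v - s k • J v‖ * (Real.sqrt N * ‖u‖) := by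
  have h1 := h.sign_mul_self k
  have h2 : ⟪v - s k • J v, A u⟫_ℝ = 1 / 2 * ⟪v - s k • J v, A u - s k • J (A u)⟫_ℝ := by
    simp only [inner_sub_left, inner_sub_right, inner_smul_left, inner_smul_right, h.J_inner_J,
      h.J_symm v]
    simp
    linear_combination (-1 / 2 * ⟪v, A u⟫_ℝ) * h1
  rw [h2, abs_mul]
  have h3 := (abs_real_inner_le_norm (v - s k • J v) (A u - s k • J (A u))).trans
    (mul_le_mul_of_nonneg_left (h.block_bound k u) (norm_nonneg _))
  rw [abs_of_pos (by norm_num : (0 : ℝ) < 1 / 2)]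
  linarith

lemma norm_dual_step_sq_le (h : CoordinateRun A J c x₀ xs γ N a s x q y) (k : ℕ) :
    ‖y (k + 1) - y k‖ ^ 2 ≤ 4 * γ ^ 2 * (N * a k ^ 2) * ‖xs - x k‖ ^ 2 := by
  have h1 : y (k + 1) - y k = (γ * a k) • (A (x k - xs) - s k • J (A (x k - xs))) := by
    rw [h.y_succ, map_smul, smul_sub, smul_comm]; abel
  rw [h1, norm_smul, mul_pow, Real.norm_eq_abs, sq_abs]
  have h2 := pow_le_pow_left₀ (norm_nonneg _) (h.block_bound k (x k - xs)) 2
  rw [mul_pow, mul_pow, Real.sq_sqrt h.N_nonneg, norm_sub_rev (x k) xs] at h2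
  calc _ ≤ (γ * a k) ^ 2 * (2 ^ 2 * N * ‖xs - x k‖ ^ 2) := by gcongr
    _ = _ := by ring

/-- As `1 - s J` is twice a projection, pairing the dual step with the full residual gives back the
squared step. This makes the extrapolation term in `q` a source of positive squares. -/
lemma two_mul_inner_dual_step (h : CoordinateRun A J c x₀ xs γ N a s x q y) (k : ℕ) :
    2 * a k * ⟪y (k + 1) - y k, A (x k - xs)⟫_ℝ = ‖y (k + 1) - y k‖ ^ 2 / γ := by
  have h1 := h.inner_sub_sign_J_self k ((γ * a k) • A (x k - xs))
  have hγ := h.γ_pos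
  rw [h.y_succ, add_sub_cancel_left, ← h1, inner_smul_right]
  field_simp

/-- The part of the dual steps that is left after the extrapolation error is paid for by the strong
convexity of the proximal term. -/
lemma extrapolation_bound (h : CoordinateRun A J c x₀ xs γ N a s x q y) (k : ℕ) (r : ℝ)
    (hrk : 2 * (N * a k ^ 2) ≤ r * (1 + (a 0 + ∑ i ∈ range (k + 1), a i))) :
    (1 - r) / γ * ‖y (k + 1) - y k‖ ^ 2 ≤ 2 * a k * ⟪y (k + 1) - y k, A (x (k + 1) - xs)⟫_ℝ
      + γ * (1 + (a 0 + ∑ i ∈ range (k + 1), a i)) / 2 * ‖x (k + 1) - x k‖ ^ 2 := by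
  have hγ := h.γ_pos
  set B := 1 + (a 0 + ∑ i ∈ range (k + 1), a i) with hB
  have hBpos : 0 < B := by
    have := h.sum_nonneg (k + 1); have := h.a_pos 0; positivity
  have h1 := h.two_mul_inner_dual_step k
  have h2 := h.abs_inner_block_le k ((γ * a k) • A (x k - xs)) (x (k + 1) - x k)
  have h3 : y (k + 1) - y k = (γ * a k) • A (x k - xs) - s k • J ((γ * a k) • A (x k - xs)) := by
    rw [h.y_succ, add_sub_cancel_left]
  rw [← h3] at h2
  have h4 : A (x (k + 1) - xs) = A (x k - xs) + A (x (k + 1) - x k) := by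
    rw [← map_add]; congr 1; abel
  rw [h4, inner_add_right, mul_add, h1]
  have h5 : -(‖y (k + 1) - y k‖ * (Real.sqrt N * ‖x (k + 1) - x k‖))
      ≤ ⟪y (k + 1) - y k, A (x (k + 1) - x k)⟫_ℝ := (abs_le.mp h2).1
  have ha := h.a_pos k
  set D := ‖y (k + 1) - y k‖
  set X := ‖x (k + 1) - x k‖
  -- Completing the square in `X`; the coefficient left on `D ^ 2` is at most `r / γ` by the
  -- step-size condition `hrk`.
  have h6 : 2 * a k * (D * (Real.sqrt N * X)) ≤ r / γ * D ^ 2 + γ * B / 2 * X ^ 2 := by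
    have hsq : 0 ≤ γ * B / 2 * (X - 2 * a k * Real.sqrt N * D / (γ * B)) ^ 2 := by positivity
    have he : γ * B / 2 * (X - 2 * a k * Real.sqrt N * D / (γ * B)) ^ 2
        = γ * B / 2 * X ^ 2 - 2 * a k * (D * (Real.sqrt N * X))
          + 2 * (Real.sqrt N ^ 2 * a k ^ 2) / (γ * B) * D ^ 2 := by
      field_simp
      ring
    rw [Real.sq_sqrt h.N_nonneg] at he
    have h7 : 2 * (N * a k ^ 2) / (γ * B) ≤ r / γ := by
      rw [div_le_div_iff₀ (by positivity) hγ]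
      nlinarith
    have := mul_le_mul_of_nonneg_right h7 (sq_nonneg D)
    linarith
  have h8 := mul_le_mul_of_nonneg_left h5 (by positivity : 0 ≤ 2 * a k)
  have h9 : (1 - r) / γ * D ^ 2 = D ^ 2 / γ - r / γ * D ^ 2 := by ring
  rw [h9]
  linarith

/-- Estimate-sequence induction: passing from `q k` to `q (k + 1)` adds one Lagrangian term and one
extrapolation term, and optimality of `x k` supplies the quadratic growth that `extrapolation_bound`
spends. Each dual step leaves `3/(4γ)` of its square, except the first, which leaves only `1/(2γ)`
because `a 0` is larger; the conditional term records this deficit. -/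
lemma proxObj_lower_bound (h : CoordinateRun A J c x₀ xs γ N a s x q y) (k : ℕ) :
    ⟪q k, xs⟫_ℝ - (∑ i ∈ range (k + 1), a i) * ⟪c, xs⟫_ℝ
      + ∑ i ∈ range (k + 1), a i * (regObj γ c (x i) + ⟪y i, A (x i - xs)⟫_ℝ)
      + (3 / (4 * γ) * ∑ i ∈ range k, ‖y (i + 1) - y i‖ ^ 2
        - (if k = 0 then 0 else 1 / (4 * γ) * ‖y 1 - y 0‖ ^ 2))
      ≤ proxObj γ (a 0 + ∑ i ∈ range (k + 1), a i) (q k) x₀ (x k) := by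
  have hγ := h.γ_pos
  induction k with
  | zero =>
    have ha := h.a_pos 0
    simp only [zero_add, range_one, sum_singleton, h.q_zero, inner_smul_left, h.y_zero,
      inner_zero_left, range_zero, sum_empty, regObj, proxObj, if_true]
    simp
    have h1 : 0 ≤ γ * a 0 / 2 * ‖x 0‖ ^ 2 := by positivity
    have h2 : 0 ≤ γ / 2 * ‖x 0 - x₀‖ ^ 2 := by positivity
    nlinarith
  | succ k ih =>
    have h1 := h.opt_succ k
    have hq1 := h.q_succ k (x (k + 1))
    have hq2 := h.q_succ k xs
    have hext : 3 / (4 * γ) * ‖y (k + 1) - y k‖ ^ 2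
        - (if k = 0 then 1 / (4 * γ) * ‖y 1 - y 0‖ ^ 2 else 0)
        ≤ 2 * a k * ⟪y (k + 1) - y k, A (x (k + 1) - xs)⟫_ℝ
      + γ * (1 + (a 0 + ∑ i ∈ range (k + 1), a i)) / 2 * ‖x (k + 1) - x k‖ ^ 2 := by
      rcases Nat.eq_zero_or_pos k with rfl | hk
      · refine le_trans (le_of_eq ?_) (h.extrapolation_bound 0 (1 / 2) ?_)
        · rw [if_pos rfl]; field_simp; ring
        · have := h.sum_nonneg 1; have := h.a_pos 0; have := h.a_zero_sq
          simp only [zero_add] at *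
          linarith
      · obtain ⟨j, rfl⟩ := Nat.exists_eq_succ_of_ne_zero hk.ne'
        refine le_trans (le_of_eq ?_) (h.extrapolation_bound (j + 1) (1 / 4) ?_)
        · rw [if_neg (by omega)]; field_simp; ring
        · have h3 := h.a_succ_sq j; have := h.sum_nonneg (j + 2); have := h.a_pos 0
          have h4 : 0 ≤ N * a (j + 1) ^ 2 := mul_nonneg h.N_nonneg (sq_nonneg _)
          simp only [add_assoc, Nat.reduceAdd] at *
          linarith
    have hif : (if k + 1 = 0 then (0 : ℝ) else 1 / (4 * γ) * ‖y 1 - y 0‖ ^ 2)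
        = (if k = 0 then 0 else 1 / (4 * γ) * ‖y 1 - y 0‖ ^ 2)
          + (if k = 0 then 1 / (4 * γ) * ‖y 1 - y 0‖ ^ 2 else 0) := by
      by_cases hk : k = 0 <;> simp [hk]
    rw [hif, sum_range_succ a (k + 1), sum_range_succ (fun i => ‖y (i + 1) - y i‖ ^ 2), mul_add,
      sum_range_succ (fun i => a i * (regObj γ c (x i) + ⟪y i, A (x i - xs)⟫_ℝ))]
    unfold proxObj regObj at *
    rw [map_sub, inner_sub_right] at hext
    rw [hq1, hq2, map_sub, inner_sub_right]
    linarith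

/-- The weighted sum of Lagrangian values, with all dual steps as slack. -/
lemma sum_lagrangian_le (h : CoordinateRun A J c x₀ xs γ N a s x q y) (k : ℕ) :
    ∑ i ∈ range (k + 1), a i * (regObj γ c (x i) - regObj γ c xs + ⟪y i, A (x i - xs)⟫_ℝ)
      + 3 / (4 * γ) * ∑ i ∈ range (k + 1), ‖y (i + 1) - y i‖ ^ 2 ≤ 2 * γ := by
  have hγ := h.γ_pos
  have h1 := h.proxObj_lower_bound k
  have h2 := h.opt_xs k
  have ha := h.a_pos 0
  -- The lower bound contains only the dual steps before the last. The last one is paid for by the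
  -- growth of the proximal objective between `x k` and `xs`.
  have hlast : 3 / (4 * γ) * ‖y (k + 1) - y k‖ ^ 2
      - (if k = 0 then 1 / (4 * γ) * ‖y 1 - y 0‖ ^ 2 else 0)
      ≤ γ * (1 + (a 0 + ∑ i ∈ range (k + 1), a i)) / 2 * ‖xs - x k‖ ^ 2 := by
    have h3 := h.norm_dual_step_sq_le k
    rcases Nat.eq_zero_or_pos k with rfl | hk
    · rw [if_pos rfl]
      have h4 : 1 / (2 * γ) * ‖y (0 + 1) - y 0‖ ^ 2
          ≤ 1 / (2 * γ) * (4 * γ ^ 2 * (N * a 0 ^ 2) * ‖xs - x 0‖ ^ 2) := by gcongr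
      have h5 : 1 / (2 * γ) * (4 * γ ^ 2 * (N * a 0 ^ 2) * ‖xs - x 0‖ ^ 2)
          = γ / 2 * (4 * N * a 0 ^ 2) * ‖xs - x 0‖ ^ 2 := by field_simp
      have h6 : γ / 2 * (4 * N * a 0 ^ 2) * ‖xs - x 0‖ ^ 2
          ≤ γ / 2 * (1 + (a 0 + ∑ i ∈ range (0 + 1), a i)) * ‖xs - x 0‖ ^ 2 := by
        have := h.sum_nonneg (0 + 1); have := h.a_zero_sq
        gcongr
        linarith
      refine le_trans (le_of_eq ?_) (h4.trans (h5.le.trans (h6.trans (le_of_eq ?_))))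
      · field_simp; ring
      · ring
    · obtain ⟨j, rfl⟩ := Nat.exists_eq_succ_of_ne_zero hk.ne'
      rw [if_neg (by omega)]
      have h4 : 3 / (4 * γ) * ‖y (j + 1 + 1) - y (j + 1)‖ ^ 2
          ≤ 3 / (4 * γ) * (4 * γ ^ 2 * (N * a (j + 1) ^ 2) * ‖xs - x (j + 1)‖ ^ 2) := by gcongr
      have h5 : 3 / (4 * γ) * (4 * γ ^ 2 * (N * a (j + 1) ^ 2) * ‖xs - x (j + 1)‖ ^ 2)
          = γ / 2 * (6 * N * a (j + 1) ^ 2) * ‖xs - x (j + 1)‖ ^ 2 := by field_simp; ring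
      have h6 : γ / 2 * (6 * N * a (j + 1) ^ 2) * ‖xs - x (j + 1)‖ ^ 2
          ≤ γ / 2 * (1 + (a 0 + ∑ i ∈ range (j + 2), a i)) * ‖xs - x (j + 1)‖ ^ 2 := by
        have h7 := h.a_succ_sq j
        have h8 : 0 ≤ N * a (j + 1) ^ 2 := mul_nonneg h.N_nonneg (sq_nonneg _)
        gcongr
        linarith
      refine le_trans (le_of_eq ?_) (h4.trans (h5.le.trans (h6.trans (le_of_eq ?_))))
      · ring
      · ring
  -- The deficit of the first dual step. Together with the two estimates of `γ/2` and `γ` below it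
  -- makes up the constant `2γ`.
  have hfirst : 1 / (4 * γ) * ‖y 1 - y 0‖ ^ 2 ≤ γ / 2 := by
    have h3 := h.norm_dual_step_sq_le 0
    have h4 := h.x_zero
    rw [norm_sub_rev] at h4
    have h5 : ‖y (0 + 1) - y 0‖ ^ 2 ≤ γ ^ 2 * 1 * 2 := by
      refine h3.trans ?_
      rw [show 4 * γ ^ 2 * (N * a 0 ^ 2) = γ ^ 2 * (4 * N * a 0 ^ 2) by ring]
      have := h.a_zero_sq
      have : 0 ≤ 4 * N * a 0 ^ 2 := by have := h.N_nonneg; positivity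
      gcongr
    calc _ ≤ 1 / (4 * γ) * (γ ^ 2 * 1 * 2) := by gcongr
      _ = γ / 2 := by field_simp; ring
  have hif : (if k = 0 then (0 : ℝ) else 1 / (4 * γ) * ‖y 1 - y 0‖ ^ 2)
        + (if k = 0 then 1 / (4 * γ) * ‖y 1 - y 0‖ ^ 2 else 0) ≤ γ / 2 := by
    by_cases hk : k = 0 <;> simpa [hk] using hfirst
  -- The quadratic weight in the proximal objective counts `a 0` twice, the linear term only once;
  -- this is the surplus at `xs`.
  have hxs : γ * a 0 / 2 * ‖xs‖ ^ 2 ≤ γ * 1 / 2 * 1 := by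
    have := h.xs_norm; have := h.a_zero_le
    gcongr
  have hxs0 : γ / 2 * ‖xs - x₀‖ ^ 2 ≤ γ / 2 * 2 := by
    have := h.xs_sub
    gcongr
  have hsum : ∑ i ∈ range (k + 1), a i * (regObj γ c (x i) - regObj γ c xs + ⟪y i, A (x i - xs)⟫_ℝ)
      = ∑ i ∈ range (k + 1), a i * (regObj γ c (x i) + ⟪y i, A (x i - xs)⟫_ℝ)
        - (∑ i ∈ range (k + 1), a i) * regObj γ c xs := by
    rw [sum_mul, ← sum_sub_distrib]
    exact sum_congr rfl fun i _ => by ring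
  rw [hsum, sum_range_succ (fun i => ‖y (i + 1) - y i‖ ^ 2), mul_add]
  unfold proxObj at *
  have hreg : (∑ i ∈ range (k + 1), a i) * regObj γ c xs
      = (∑ i ∈ range (k + 1), a i) * ⟪c, xs⟫_ℝ
        + γ * (∑ i ∈ range (k + 1), a i) / 2 * ‖xs‖ ^ 2 := by
    unfold regObj; ring
  rw [hreg]
  have hB : γ * (a 0 + ∑ i ∈ range (k + 1), a i) / 2 * ‖xs‖ ^ 2 = γ * a 0 / 2 * ‖xs‖ ^ 2
      + γ * (∑ i ∈ range (k + 1), a i) / 2 * ‖xs‖ ^ 2 := by ring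
  linarith

/-- The predictable factor of the `k`-th martingale increment. -/
def noise (A : E →ₗ[ℝ] H) (J : H →ₗ[ℝ] H) (xs : E) (γ : ℝ) (a : ℕ → ℝ) (x : ℕ → E)
    (y : ℕ → H) (k : ℕ) : ℝ :=
  ⟪(1 / 2 : ℝ) • ((γ * a k) • A (x k - xs)) + ∑ i ∈ range k, (γ * a i) • A (x i - xs)
    - (2 : ℝ) • y k, J ((γ * a k) • A (x k - xs))⟫_ℝ

/-- With `v` the full gradient step, `v` minus the dual step is `s • J v`, whose norm is that of
`v`. The terms in `‖v‖ ^ 2` then cancel and everything left is linear in the sign, which is what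
makes it a martingale. -/
lemma sum_signed_noise (h : CoordinateRun A J c x₀ xs γ N a s x q y) (k : ℕ) :
    1 / 2 * ‖∑ i ∈ range k, (γ * a i) • A (x i - xs) - y k‖ ^ 2
      - 1 / 4 * ∑ i ∈ range k, ‖y (i + 1) - y i‖ ^ 2
      - ∑ i ∈ range k, ⟪y i, (γ * a i) • A (x i - xs) - (y (i + 1) - y i)⟫_ℝ
      = ∑ i ∈ range k, s i * noise A J xs γ a x y i := by
  induction k with
  | zero => simp [h.y_zero]
  | succ k ih =>
    rw [sum_range_succ, sum_range_succ _ k, sum_range_succ _ k, sum_range_succ _ k, ← ih]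
    have hd : y (k + 1) - y k
        = (γ * a k) • A (x k - xs) - s k • J ((γ * a k) • A (x k - xs)) := by
      rw [h.y_succ, add_sub_cancel_left]
    set v := (γ * a k) • A (x k - xs)
    set G := ∑ i ∈ range k, (γ * a i) • A (x i - xs)
    have hn : noise A J xs γ a x y k = ⟪(1 / 2 : ℝ) • v + G - (2 : ℝ) • y k, J v⟫_ℝ := rfl
    have h1 : G + v - y (k + 1) = (G - y k) + s k • J v := by
      rw [h.y_succ]; abel
    have h2 : v - (y (k + 1) - y k) = s k • J v := by rw [hd]; abel
    have h3 : ‖J v‖ ^ 2 = ‖v‖ ^ 2 := by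
      rw [← real_inner_self_eq_norm_sq, h.J_inner_J, real_inner_self_eq_norm_sq]
    have h4 : ‖y (k + 1) - y k‖ ^ 2 = 2 * ‖v‖ ^ 2 - 2 * s k * ⟪v, J v⟫_ℝ := by
      rw [hd, h.norm_sub_sign_J_sq]
    rw [h1, h2, h4, norm_add_sq_real, norm_smul, mul_pow, Real.norm_eq_abs, sq_abs, h3, hn]
    simp only [inner_smul_right, inner_sub_left, inner_add_left, inner_smul_left,
      RCLike.conj_to_real]
    linear_combination (1 / 2 * ‖v‖ ^ 2) * h.sign_mul_self k

/-- The basic inequality of the method on every path. -/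
theorem gap_add_residual_le (h : CoordinateRun A J c x₀ xs γ N a s x q y) {R : ℝ} (hR : 0 ≤ R)
    (k : ℕ) :
    ∑ i ∈ range (k + 1), a i * (regObj γ c (x i) - regObj γ c xs)
      + R * ‖∑ i ∈ range (k + 1), a i • A (x i - xs)‖
      ≤ 2 * γ + R ^ 2 / γ + 1 / γ * ∑ i ∈ range (k + 1), s i * noise A J xs γ a x y i := by
  have hγ := h.γ_pos
  have h1 := h.sum_lagrangian_le k
  have h2 := h.sum_signed_noise (k + 1)
  set G := ∑ i ∈ range (k + 1), a i • A (x i - xs) with hG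
  have hGγ : ∑ i ∈ range (k + 1), (γ * a i) • A (x i - xs) = γ • G := by
    rw [hG, smul_sum]
    exact sum_congr rfl fun i _ => by rw [mul_smul]
  rw [hGγ] at h2
  -- A dual test vector of norm at most `R` that realises `R * ‖G‖`. It depends on the whole path,
  -- so it is never paired with the noise directly.
  obtain ⟨w, hw, hwG⟩ : ∃ w : H, ‖w‖ ≤ R ∧ ⟪w, G⟫_ℝ = R * ‖G‖ := by
    by_cases hz : G = 0
    · exact ⟨0, by simpa using hR, by simp [hz]⟩
    · have hn : ‖G‖ ≠ 0 := norm_ne_zero_iff.mpr hz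
      refine ⟨(R / ‖G‖) • G, ?_, ?_⟩
      · rw [norm_smul, Real.norm_eq_abs, abs_of_nonneg (by positivity)]
        field_simp
        exact le_rfl
      · rw [inner_smul_left, real_inner_self_eq_norm_sq]
        simp
        field_simp
  have htel : ∀ j, ∑ i ∈ range j, (‖y (i + 1) - y i‖ ^ 2 + 2 * ⟪y i, y (i + 1) - y i⟫_ℝ)
      = ‖y j‖ ^ 2 := by
    intro j
    induction j with
    | zero => simp [h.y_zero]
    | succ j ih =>
      rw [sum_range_succ, ih]
      have : y (j + 1) = y j + (y (j + 1) - y j) := by abel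
      conv_rhs => rw [this, norm_add_sq_real]
      ring
  have htel' := htel (k + 1)
  rw [sum_add_distrib, ← mul_sum] at htel'
  have hsplit : ∑ i ∈ range (k + 1), ⟪y i, (γ * a i) • A (x i - xs) - (y (i + 1) - y i)⟫_ℝ
      = γ * ∑ i ∈ range (k + 1), a i * ⟪y i, A (x i - xs)⟫_ℝ
        - ∑ i ∈ range (k + 1), ⟪y i, y (i + 1) - y i⟫_ℝ := by
    rw [mul_sum, ← sum_sub_distrib]
    refine sum_congr rfl fun i _ => ?_
    rw [inner_sub_right, inner_smul_right]
    ring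
  rw [hsplit] at h2
  have hsum : ∑ i ∈ range (k + 1), a i * (regObj γ c (x i) - regObj γ c xs + ⟪y i, A (x i - xs)⟫_ℝ)
      = ∑ i ∈ range (k + 1), a i * (regObj γ c (x i) - regObj γ c xs)
        + ∑ i ∈ range (k + 1), a i * ⟪y i, A (x i - xs)⟫_ℝ := by
    rw [← sum_add_distrib]
    exact sum_congr rfl fun i _ => by ring
  rw [hsum] at h1
  have hw2 : ‖w‖ ^ 2 ≤ R ^ 2 := by gcongr
  -- Splitting off `y (k + 1)`: the square of `γ • G - y (k + 1)` contributes `1/4` and that of `y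
  -- (k + 1)` contributes `1/2` of the sum of squared dual steps, together the `3/4` available in
  -- `h1'`.
  have hy1 : γ * (R * ‖G‖) = ⟪w, γ • G - y (k + 1)⟫_ℝ + ⟪w, y (k + 1)⟫_ℝ := by
    rw [inner_sub_right, inner_smul_right, hwG]; ring
  have hy2 : ⟪w, γ • G - y (k + 1)⟫_ℝ ≤ 1 / 2 * ‖w‖ ^ 2 + 1 / 2 * ‖γ • G - y (k + 1)‖ ^ 2 := by
    have := norm_sub_sq_real w (γ • G - y (k + 1))
    nlinarith [sq_nonneg ‖w - (γ • G - y (k + 1))‖]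
  have hy3 : ⟪w, y (k + 1)⟫_ℝ ≤ 1 / 2 * ‖w‖ ^ 2 + 1 / 2 * ‖y (k + 1)‖ ^ 2 := by
    have := norm_sub_sq_real w (y (k + 1))
    nlinarith [sq_nonneg ‖w - y (k + 1)‖]
  have h1' := mul_le_mul_of_nonneg_left h1 hγ.le
  have hc : γ * (3 / (4 * γ) * ∑ i ∈ range (k + 1), ‖y (i + 1) - y i‖ ^ 2)
      = 3 / 4 * ∑ i ∈ range (k + 1), ‖y (i + 1) - y i‖ ^ 2 := by field_simp
  rw [mul_add, mul_add, hc] at h1'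
  refine le_of_mul_le_mul_left ?_ hγ
  have hrhs : γ * (2 * γ + R ^ 2 / γ
      + 1 / γ * ∑ i ∈ range (k + 1), s i * noise A J xs γ a x y i)
      = γ * (2 * γ) + R ^ 2 + ∑ i ∈ range (k + 1), s i * noise A J xs γ a x y i := by
    field_simp
  rw [hrhs, mul_add]
  linarith

end CoordinateRun

end Abstract

/-! ### Growth and regularity of the step sizes -/

section StepSizes

open Finset

/-- The pair `(a_k, A_k)` of step size and weight for equal proximal and regularisation
parameters. -/
def stepWeight (N : ℝ) : ℕ → ℝ × ℝ
  | 0 => (1 / (2 * Real.sqrt N), 1 / (2 * Real.sqrt N))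
  | k + 1 => (1 / 4 * Real.sqrt ((1 + (stepWeight N k).2) / N),
      (stepWeight N k).2 + (stepWeight N k).1)

/-- The step size `a_k`. -/
def stepSize (N : ℝ) (k : ℕ) : ℝ := (stepWeight N k).1

/-- The weight `A_k`. -/
def totalWeight (N : ℝ) (k : ℕ) : ℝ := (stepWeight N k).2

variable {N : ℝ}

lemma totalWeight_zero (N : ℝ) : totalWeight N 0 = stepSize N 0 := rfl

lemma totalWeight_succ (N : ℝ) (k : ℕ) :
    totalWeight N (k + 1) = totalWeight N k + stepSize N k := rfl

lemma stepSize_succ (N : ℝ) (k : ℕ) :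
    stepSize N (k + 1) = 1 / 4 * Real.sqrt ((1 + totalWeight N k) / N) := rfl

lemma totalWeight_eq_sum (N : ℝ) (k : ℕ) :
    totalWeight N k = stepSize N 0 + ∑ i ∈ range k, stepSize N i := by
  induction k with
  | zero => simp [totalWeight_zero]
  | succ k ih => rw [totalWeight_succ, ih, sum_range_succ, add_assoc]

lemma stepSize_zero_sq (hN : 0 < N) : 4 * N * stepSize N 0 ^ 2 = 1 := by
  change 4 * N * (1 / (2 * Real.sqrt N)) ^ 2 = 1
  rw [div_pow, mul_pow, Real.sq_sqrt hN.le]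
  field_simp
  norm_num

lemma stepSize_nonneg (N : ℝ) (k : ℕ) : 0 ≤ stepSize N k := by
  cases k with
  | zero => change 0 ≤ 1 / (2 * Real.sqrt N); positivity
  | succ k => rw [stepSize_succ]; positivity

lemma totalWeight_nonneg (N : ℝ) (k : ℕ) : 0 ≤ totalWeight N k := by
  rw [totalWeight_eq_sum]
  exact add_nonneg (stepSize_nonneg N 0) (sum_nonneg fun i _ => stepSize_nonneg N i)

lemma stepSize_succ_sq (hN : 0 < N) (k : ℕ) :
    16 * N * stepSize N (k + 1) ^ 2 = 1 + totalWeight N k := by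
  have := totalWeight_nonneg N k
  rw [stepSize_succ, mul_pow, Real.sq_sqrt (by positivity)]
  field_simp
  norm_num

lemma stepSize_pos (hN : 0 < N) (k : ℕ) : 0 < stepSize N k := by
  cases k with
  | zero => change 0 < 1 / (2 * Real.sqrt N); positivity
  | succ k =>
    have := totalWeight_nonneg N k
    rw [stepSize_succ]; positivity

lemma totalWeight_pos (hN : 0 < N) (k : ℕ) : 0 < totalWeight N k := by
  rw [totalWeight_eq_sum]
  exact add_pos_of_pos_of_nonneg (stepSize_pos hN 0) (sum_nonneg fun i _ => stepSize_nonneg N i)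

lemma totalWeight_mono (N : ℝ) : Monotone (totalWeight N) :=
  monotone_nat_of_le_succ fun k => by
    rw [totalWeight_succ]; linarith [stepSize_nonneg N k]

lemma stepSize_zero_le (hN : 2 ≤ N) : stepSize N 0 ≤ 1 / 2 := by
  have h := stepSize_zero_sq (by linarith : 0 < N)
  have h0 := stepSize_nonneg N 0
  by_contra hlt
  push Not at hlt
  nlinarith [sq_nonneg (stepSize N 0)]

lemma stepSize_le (hN : 2 ≤ N) (k : ℕ) : stepSize N k ≤ 1 + totalWeight N k := by
  cases k with
  | zero => rw [totalWeight_zero]; linarith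
  | succ k =>
    have h := stepSize_succ_sq (by linarith : 0 < N) k
    have h0 := stepSize_nonneg N (k + 1)
    have h1 := totalWeight_nonneg N k
    rw [totalWeight_succ]
    have h2 := stepSize_nonneg N k
    have h3 : stepSize N (k + 1) ^ 2 ≤ (1 + totalWeight N k) ^ 2 := by
      nlinarith [sq_nonneg (stepSize N (k + 1))]
    linarith [(sq_le_sq₀ h0 (by linarith)).mp h3]

lemma one_add_totalWeight_succ_le (hN : 2 ≤ N) (k : ℕ) :
    1 + totalWeight N (k + 1) ≤ 2 * (1 + totalWeight N k) := by
  rw [totalWeight_succ]; linarith [stepSize_le hN k]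

/-- The steps are `a_{k+1} = 8 t √(1 + A_k)` with `t = 1/(32 √N)`, so `√(1 + A_k)` grows at least
linearly with slope `t`. The factor `8` leaves room for the lag by one index in the recursion. -/
lemma one_add_sq_le_totalWeight (hN : 2 ≤ N) (k : ℕ) :
    (1 + k * (1 / (32 * Real.sqrt N))) ^ 2 ≤ 1 + totalWeight N k := by
  have hN0 : 0 < N := by linarith
  have hs : 1 ≤ Real.sqrt N := by rw [Real.one_le_sqrt]; linarith
  set t := 1 / (32 * Real.sqrt N) with ht
  have ht0 : 0 < t := by positivity
  have ht1 : t ≤ 1 := by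
    rw [ht, div_le_one (by positivity)]; linarith
  induction k using Nat.strong_induction_on with
  | _ k ih =>
    rcases k with _ | k
    · have := totalWeight_nonneg N 0
      simp; exact this
    · have h1 := ih k (by omega)
      rw [totalWeight_succ]
      push_cast
      -- The left side is the increment of the square from `k` to `k + 1`.
      suffices 2 * t * (1 + k * t) + t ^ 2 ≤ stepSize N k by nlinarith
      rcases k with _ | j
      · have : stepSize N 0 = 16 * t := by
          change 1 / (2 * Real.sqrt N) = _
          rw [ht]; field_simp; norm_num
        rw [this]; push_cast; nlinarith
      · have h2 := ih j (by omega)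
        have h3 : stepSize N (j + 1) = 8 * t * Real.sqrt (1 + totalWeight N j) := by
          rw [stepSize_succ, Real.sqrt_div' _ hN0.le, ht]
          field_simp; ring
        have h4 : 1 + j * t ≤ Real.sqrt (1 + totalWeight N j) := Real.le_sqrt_of_sq_le h2
        have h5 : 8 * t * (1 + j * t) ≤ 8 * t * Real.sqrt (1 + totalWeight N j) := by gcongr
        rw [h3]
        refine le_trans ?_ h5
        push_cast
        have : 0 ≤ (j : ℝ) * t * t := by positivity
        nlinarith

lemma sq_le_totalWeight (hN : 2 ≤ N) (k : ℕ) : (k : ℝ) ^ 2 ≤ 1024 * N * totalWeight N k := by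
  have h := one_add_sq_le_totalWeight hN k
  have hN0 : 0 < N := by linarith
  have h1 : ((k : ℝ) * (1 / (32 * Real.sqrt N))) ^ 2 ≤ totalWeight N k := by
    have : 0 ≤ (k : ℝ) * (1 / (32 * Real.sqrt N)) := by positivity
    nlinarith
  rw [mul_pow, div_pow, mul_pow, Real.sq_sqrt hN0.le, one_pow] at h1
  rw [mul_one_div, div_le_iff₀ (by positivity)] at h1
  linarith

/-- Bounds the normalisation defect of the average, which is governed by the last step and `a_0`,
relative to the total weight: it decays like `1/k`. -/
lemma last_step_mul_le (hN : 2 ≤ N) {k : ℕ} (hk : 1 ≤ k) (h1 : 1 ≤ totalWeight N k) :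
    (stepSize N k + 2 * stepSize N 0) * k ≤ 48 * totalWeight N k := by
  have hN0 : 0 < N := by linarith
  obtain ⟨j, rfl⟩ := Nat.exists_eq_succ_of_ne_zero (by omega : k ≠ 0)
  simp only [Nat.succ_eq_add_one] at *
  have h2 := stepSize_succ_sq hN0 j
  have h3 := stepSize_zero_sq hN0
  have h4 := totalWeight_mono N (Nat.le_succ j)
  have h5 := sq_le_totalWeight hN (j + 1)
  simp only [Nat.succ_eq_add_one] at h4
  set W := totalWeight N (j + 1)
  have ha := stepSize_nonneg N (j + 1)
  have hb := stepSize_nonneg N 0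
  set p := stepSize N (j + 1)
  set r := stepSize N 0
  -- Here `N p² ≤ W/8` and `N r² = 1/4 ≤ W/4`, both using `W ≥ 1`. Combined with `k² ≤ 1024 N W`
  -- this yields `48² = 1024 · 9/4`.
  have h6 : N * (p + 2 * r) ^ 2 ≤ 9 / 4 * W := by
    have : N * (p + 2 * r) ^ 2 ≤ N * (2 * (p ^ 2 + 4 * r ^ 2)) := by
      gcongr
      nlinarith [sq_nonneg (p - 2 * r)]
    nlinarith
  have h7 : N * ((p + 2 * r) * ((j + 1 : ℕ) : ℝ)) ^ 2 ≤ N * (48 * W) ^ 2 := by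
    calc N * ((p + 2 * r) * ((j + 1 : ℕ) : ℝ)) ^ 2
        = (N * (p + 2 * r) ^ 2) * ((j + 1 : ℕ) : ℝ) ^ 2 := by ring
      _ ≤ (9 / 4 * W) * (1024 * N * W) := by gcongr
      _ = N * (48 * W) ^ 2 := by ring
  have h8 := le_of_mul_le_mul_left h7 hN0
  exact (sq_le_sq₀ (by positivity) (by positivity)).mp h8

/-- The factor by which the averaging weight of an iterate exceeds its step size. -/
def stepRatio (N : ℝ) (k : ℕ) : ℝ := stepSize N (k + 1) / stepSize N k

lemma stepRatio_nonneg (N : ℝ) (k : ℕ) : 0 ≤ stepRatio N k :=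
  div_nonneg (stepSize_nonneg N _) (stepSize_nonneg N _)

lemma stepRatio_mul (hN : 0 < N) (k : ℕ) : stepRatio N k * stepSize N k = stepSize N (k + 1) :=
  div_mul_cancel₀ _ (stepSize_pos hN k).ne'

lemma stepRatio_le (hN : 2 ≤ N) (k : ℕ) : stepRatio N k ≤ 2 := by
  have hN0 : 0 < N := by linarith
  rw [stepRatio, div_le_iff₀ (stepSize_pos hN0 k)]
  refine (sq_le_sq₀ (stepSize_nonneg N _) (by have := stepSize_nonneg N k; positivity)).mp ?_
  refine le_of_mul_le_mul_left ?_ (by positivity : 0 < 16 * N)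
  rw [stepSize_succ_sq hN0]
  rcases k with _ | j
  · have := stepSize_zero_sq hN0
    have := stepSize_zero_le hN
    rw [totalWeight_zero]
    nlinarith
  · have := stepSize_succ_sq hN0 j
    have := one_add_totalWeight_succ_le hN j
    have := totalWeight_nonneg N j
    nlinarith

/-- Eventual log-concavity of the step sizes. Since `16 N a_{k+1}² = 1 + A_k`, the claim reduces by
squaring, twice, to the cubic inequality `u³ ≤ w² v` between three consecutive values of `1 + A`.
The initial indices are excluded because `a_0` does not follow the recursion. -/
lemma stepRatio_succ_le (hN : 2 ≤ N) {k : ℕ} (hk : 3 ≤ k) :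
    stepRatio N (k + 1) ≤ stepRatio N k := by
  have hN0 : 0 < N := by linarith
  obtain ⟨j, rfl⟩ := Nat.exists_eq_add_of_le' hk
  rw [stepRatio, stepRatio, div_le_div_iff₀ (stepSize_pos hN0 _) (stepSize_pos hN0 _)]
  have p := stepSize_pos hN0
  have s1 := stepSize_succ_sq hN0 j
  have s2 := stepSize_succ_sq hN0 (j + 1)
  have s3 := stepSize_succ_sq hN0 (j + 2)
  have s4 := stepSize_succ_sq hN0 (j + 3)
  have s5 := stepSize_succ_sq hN0 (j + 4)
  have w1 := totalWeight_succ N (j + 1)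
  have w2 := totalWeight_succ N (j + 2)
  have w3 := totalWeight_succ N (j + 3)
  have hu := one_add_totalWeight_succ_le hN (j + 1)
  have hmono := totalWeight_mono N (Nat.le_succ j)
  have hv0 := totalWeight_nonneg N (j + 1)
  simp only [Nat.succ_eq_add_one, add_assoc, Nat.reduceAdd] at *
  have h12 : stepSize N (j + 1) ≤ stepSize N (j + 2) := by
    refine (sq_le_sq₀ (p _).le (p _).le).mp (le_of_mul_le_mul_left ?_ (by positivity : 0 < 16 * N))
    linarith
  have p2 := p (j + 2)
  have p3 := p (j + 3)
  set v := 1 + totalWeight N (j + 1) with hv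
  set u := 1 + totalWeight N (j + 2) with hu'
  set w := 1 + totalWeight N (j + 3) with hw
  have eu : u = v + stepSize N (j + 1) := by rw [hu', hv, w1]; ring
  have ew : w = u + stepSize N (j + 2) := by rw [hw, hu', w2]; ring
  have hvp : 0 < v := by rw [hv]; linarith
  have hup : 0 < u := by rw [eu]; linarith [p (j + 1)]
  have hwp : 0 < w := by rw [ew]; linarith
  -- Expanding `w = u + a_{j+2}`, it is enough that `a_{j+1} ≤ a_{j+2}` and `u ≤ 2 v`.
  have hcube : u ^ 3 ≤ w ^ 2 * v := by
    have e1 : u ^ 2 * stepSize N (j + 1) ≤ u ^ 2 * stepSize N (j + 2) := by gcongr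
    have e2 : u * stepSize N (j + 2) * u ≤ u * stepSize N (j + 2) * (2 * v) := by gcongr
    have e3 : 0 ≤ stepSize N (j + 2) ^ 2 * v := by positivity
    have e4 : u ^ 3 = u ^ 2 * v + u ^ 2 * stepSize N (j + 1) := by
      rw [show u ^ 3 = u ^ 2 * u by ring]
      nth_rewrite 2 [eu]; ring
    rw [e4, ew]
    nlinarith
  have hlin : stepSize N (j + 3) * u ≤ w * stepSize N (j + 2) := by
    refine (sq_le_sq₀ (by positivity) (by positivity)).mp
      (le_of_mul_le_mul_left ?_ (by positivity : 0 < 16 * N))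
    calc 16 * N * (stepSize N (j + 3) * u) ^ 2 = (16 * N * stepSize N (j + 3) ^ 2) * u ^ 2 := by ring
      _ = u ^ 3 := by rw [s3]; ring
      _ ≤ w ^ 2 * v := hcube
      _ = 16 * N * (w * stepSize N (j + 2)) ^ 2 := by rw [← s2]; ring
  have hmul : (1 + totalWeight N (j + 4)) * u ≤ w * w := by
    rw [w3, show 1 + (totalWeight N (j + 3) + stepSize N (j + 3)) = w + stepSize N (j + 3) by
      rw [hw]; ring, add_mul]
    have : w * w = w * u + w * stepSize N (j + 2) := by linear_combination w * ew
    linarith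
  have p4 := p (j + 4)
  have p5 := p (j + 5)
  refine (sq_le_sq₀ (by positivity) (by positivity)).mp
      (le_of_mul_le_mul_left ?_ (by positivity : 0 < (16 * N) ^ 2))
  calc (16 * N) ^ 2 * (stepSize N (j + 5) * stepSize N (j + 3)) ^ 2
      = (16 * N * stepSize N (j + 5) ^ 2) * (16 * N * stepSize N (j + 3) ^ 2) := by ring
    _ = (1 + totalWeight N (j + 4)) * u := by rw [s5, s3]
    _ ≤ w * w := hmul
    _ = (16 * N) ^ 2 * (stepSize N (j + 4) * stepSize N (j + 4)) ^ 2 := by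
      rw [← s4]; ring

end StepSizes

/-! ### Rounding, weak duality and existence of optimal plans -/

section Rounding

open Finset

variable {n m : ℕ}

lemma abs_le_supNorm (C : Matrix (Fin n) (Fin m) ℝ) (i : Fin n) (j : Fin m) :
    |C i j| ≤ supNorm C :=
  le_ciSup (f := fun p : Fin n × Fin m => |C p.1 p.2|) (Set.finite_range _).bddAbove (i, j)

lemma supNorm_nonneg (C : Matrix (Fin n) (Fin m) ℝ) : 0 ≤ supNorm C :=
  Real.iSup_nonneg fun _ => abs_nonneg _

lemma le_supNorm (C : Matrix (Fin n) (Fin m) ℝ) (i : Fin n) (j : Fin m) : C i j ≤ supNorm C :=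
  (le_abs_self _).trans (abs_le_supNorm C i j)

lemma sum_rowSum (X : Matrix (Fin n) (Fin m) ℝ) : ∑ i, rowSum X i = ∑ i, ∑ j, X i j := rfl

lemma sum_colSum (X : Matrix (Fin n) (Fin m) ℝ) : ∑ j, colSum X j = ∑ i, ∑ j, X i j :=
  sum_comm

lemma rowSum_nonneg {X : Matrix (Fin n) (Fin m) ℝ} (hX : ∀ i j, 0 ≤ X i j) (i : Fin n) :
    0 ≤ rowSum X i := sum_nonneg fun j _ => hX i j

lemma colSum_mono {X Y : Matrix (Fin n) (Fin m) ℝ} (h : ∀ i j, X i j ≤ Y i j) (j : Fin m) :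
    colSum X j ≤ colSum Y j := sum_le_sum fun i _ => h i j

lemma rowSum_mono {X Y : Matrix (Fin n) (Fin m) ℝ} (h : ∀ i j, X i j ≤ Y i j) (i : Fin n) :
    rowSum X i ≤ rowSum Y i := sum_le_sum fun j _ => h i j

lemma cost_mono {C X Y : Matrix (Fin n) (Fin m) ℝ} (hC : ∀ i j, 0 ≤ C i j)
    (h : ∀ i j, X i j ≤ Y i j) : cost C X ≤ cost C Y :=
  sum_le_sum fun i _ => sum_le_sum fun j _ => mul_le_mul_of_nonneg_left (h i j) (hC i j)

lemma cost_nonneg {C X : Matrix (Fin n) (Fin m) ℝ} (hC : ∀ i j, 0 ≤ C i j)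
    (hX : ∀ i j, 0 ≤ X i j) : 0 ≤ cost C X :=
  sum_nonneg fun i _ => sum_nonneg fun j _ => mul_nonneg (hC i j) (hX i j)

section Scale

variable {a : Fin n → ℝ} {b : Fin m → ℝ} {F : Matrix (Fin n) (Fin m) ℝ}

lemma scaleRows_nonneg (ha : ∀ i, 0 ≤ a i) (hF : ∀ i j, 0 ≤ F i j) (i : Fin n) (j : Fin m) :
    0 ≤ scaleRows a F i j := by
  unfold scaleRows
  split_ifs
  · exact mul_nonneg (div_nonneg (ha i) (rowSum_nonneg hF i)) (hF i j)
  · exact hF i j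

lemma scaleRows_le (ha : ∀ i, 0 ≤ a i) (hF : ∀ i j, 0 ≤ F i j) (i : Fin n) (j : Fin m) :
    scaleRows a F i j ≤ F i j := by
  unfold scaleRows
  split_ifs with h
  · refine mul_le_of_le_one_left (hF i j) ?_
    rw [div_le_one ((ha i).trans_lt h)]
    exact h.le
  · exact le_rfl

lemma rowSum_scaleRows (ha : ∀ i, 0 ≤ a i) (i : Fin n) :
    rowSum (scaleRows a F) i = min (a i) (rowSum F i) := by
  by_cases h : a i < rowSum F i
  · have h1 : rowSum (scaleRows a F) i = ∑ j, a i / rowSum F i * F i j :=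
      sum_congr rfl fun j _ => by rw [scaleRows, if_pos h]
    rw [h1, ← mul_sum, min_eq_left h.le]
    exact div_mul_cancel₀ _ ((ha i).trans_lt h).ne'
  · have h1 : rowSum (scaleRows a F) i = ∑ j, F i j :=
      sum_congr rfl fun j _ => by rw [scaleRows, if_neg h]
    rw [h1, min_eq_right (not_lt.mp h)]
    rfl

lemma scaleCols_nonneg (hb : ∀ j, 0 ≤ b j) (hF : ∀ i j, 0 ≤ F i j) (i : Fin n) (j : Fin m) :
    0 ≤ scaleCols b F i j :=
  scaleRows_nonneg (F := F.transpose) hb (fun j i => hF i j) j i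

lemma scaleCols_le (hb : ∀ j, 0 ≤ b j) (hF : ∀ i j, 0 ≤ F i j) (i : Fin n) (j : Fin m) :
    scaleCols b F i j ≤ F i j :=
  scaleRows_le (F := F.transpose) hb (fun j i => hF i j) j i

lemma colSum_scaleCols (hb : ∀ j, 0 ≤ b j) (j : Fin m) :
    colSum (scaleCols b F) j = min (b j) (colSum F j) :=
  rowSum_scaleRows (F := F.transpose) hb j

/-- The matrix obtained by scaling rows and columns down. -/
def scaled (a : Fin n → ℝ) (b : Fin m → ℝ) (F : Matrix (Fin n) (Fin m) ℝ) :
    Matrix (Fin n) (Fin m) ℝ := scaleCols b (scaleRows a F)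

lemma scaled_nonneg (ha : ∀ i, 0 ≤ a i) (hb : ∀ j, 0 ≤ b j) (hF : ∀ i j, 0 ≤ F i j)
    (i : Fin n) (j : Fin m) : 0 ≤ scaled a b F i j :=
  scaleCols_nonneg hb (scaleRows_nonneg ha hF) i j

lemma scaled_le (ha : ∀ i, 0 ≤ a i) (hb : ∀ j, 0 ≤ b j) (hF : ∀ i j, 0 ≤ F i j)
    (i : Fin n) (j : Fin m) : scaled a b F i j ≤ F i j :=
  (scaleCols_le hb (scaleRows_nonneg ha hF) i j).trans (scaleRows_le ha hF i j)

lemma rowSum_scaled_le (ha : ∀ i, 0 ≤ a i) (hb : ∀ j, 0 ≤ b j) (hF : ∀ i j, 0 ≤ F i j)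
    (i : Fin n) : rowSum (scaled a b F) i ≤ a i :=
  (rowSum_mono (scaleCols_le hb (scaleRows_nonneg ha hF)) i).trans
    ((rowSum_scaleRows ha i).le.trans (min_le_left _ _))

lemma colSum_scaled_le (hb : ∀ j, 0 ≤ b j) (j : Fin m) : colSum (scaled a b F) j ≤ b j :=
  (colSum_scaleCols hb j).le.trans (min_le_left _ _)

lemma sum_row_defect_eq (hab : ∑ i, a i = ∑ j, b j) (G : Matrix (Fin n) (Fin m) ℝ) :
    ∑ i, (a i - rowSum G i) = ∑ j, (b j - colSum G j) := by
  rw [sum_sub_distrib, sum_sub_distrib, hab, sum_rowSum, sum_colSum]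

/-- Mass is missing after row scaling only by the row violations, since rows are brought to `min (a
i) (rowSum F i)`. Column scaling then removes only an excess over `b`, which was already present in
`F` because row scaling lowers entries. -/
lemma sum_col_defect_scaled_le (ha : ∀ i, 0 ≤ a i) (hb : ∀ j, 0 ≤ b j)
    (hF : ∀ i j, 0 ≤ F i j) (hab : ∑ i, a i = ∑ j, b j) :
    ∑ j, (b j - colSum (scaled a b F) j)
      ≤ ∑ i, |rowSum F i - a i| + ∑ j, |colSum F j - b j| := by
  have h1 : ∀ j, b j - colSum (scaled a b F) j
      ≤ (b j - colSum (scaleRows a F) j) + |colSum F j - b j| := by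
    intro j
    rw [scaled, colSum_scaleCols hb]
    have h2 := colSum_mono (scaleRows_le ha hF) j
    rcases min_cases (b j) (colSum (scaleRows a F) j) with ⟨h, h'⟩ | ⟨h, h'⟩ <;> rw [h]
    · linarith [le_abs_self (colSum F j - b j)]
    · linarith [abs_nonneg (colSum F j - b j)]
  have h3 : ∀ i, a i - rowSum (scaleRows a F) i ≤ |rowSum F i - a i| := by
    intro i
    rw [rowSum_scaleRows ha]
    rcases min_cases (a i) (rowSum F i) with ⟨h, h'⟩ | ⟨h, h'⟩ <;> rw [h]
    · linarith [abs_nonneg (rowSum F i - a i)]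
    · linarith [neg_abs_le (rowSum F i - a i)]
  calc ∑ j, (b j - colSum (scaled a b F) j)
      ≤ ∑ j, ((b j - colSum (scaleRows a F) j) + |colSum F j - b j|) :=
        sum_le_sum fun j _ => h1 j
    _ = ∑ i, (a i - rowSum (scaleRows a F) i) + ∑ j, |colSum F j - b j| := by
        rw [sum_add_distrib, sum_row_defect_eq hab]
    _ ≤ _ := by gcongr with i; exact h3 i

lemma roundPlan_apply (ha : ∀ i, 0 ≤ a i) (hb : ∀ j, 0 ≤ b j) (hF : ∀ i j, 0 ≤ F i j)
    (i : Fin n) (j : Fin m) :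
    roundPlan a b F i j = scaled a b F i j + (a i - rowSum (scaled a b F) i)
      * (b j - colSum (scaled a b F) j) / ∑ i', (a i' - rowSum (scaled a b F) i') := by
  have : ∑ i', |a i' - rowSum (scaled a b F) i'| = ∑ i', (a i' - rowSum (scaled a b F) i') :=
    sum_congr rfl fun i' _ => abs_of_nonneg (sub_nonneg.mpr (rowSum_scaled_le ha hb hF i'))
  rw [← this]
  rfl

theorem roundPlan_mem_plans (ha : ∀ i, 0 ≤ a i) (hb : ∀ j, 0 ≤ b j) (hF : ∀ i j, 0 ≤ F i j)
    (hab : ∑ i, a i = ∑ j, b j) : roundPlan a b F ∈ plans a b := by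
  have hr : ∀ i, 0 ≤ a i - rowSum (scaled a b F) i := fun i =>
    sub_nonneg.mpr (rowSum_scaled_le ha hb hF i)
  have hs : ∀ j, 0 ≤ b j - colSum (scaled a b F) j := fun j =>
    sub_nonneg.mpr (colSum_scaled_le hb j)
  have heq := sum_row_defect_eq hab (scaled a b F)
  have hap := roundPlan_apply ha hb hF
  refine ⟨fun i j => ?_, funext fun i => ?_, funext fun j => ?_⟩
  · rw [hap]
    exact add_nonneg (scaled_nonneg ha hb hF i j)
      (div_nonneg (mul_nonneg (hr i) (hs j)) (sum_nonneg fun i _ => hr i))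
  · have h1 : rowSum (roundPlan a b F) i = rowSum (scaled a b F) i
        + (a i - rowSum (scaled a b F) i) * (∑ j, (b j - colSum (scaled a b F) j))
          / ∑ i', (a i' - rowSum (scaled a b F) i') := by
      rw [mul_sum, sum_div, rowSum, rowSum, ← sum_add_distrib]
      exact sum_congr rfl fun j _ => hap i j
    rw [h1, ← heq]
    -- If no mass is missing, the quotient is zero by the convention on division, and each row
    -- defect vanishes since all are nonnegative.
    by_cases hz : ∑ i', (a i' - rowSum (scaled a b F) i') = 0
    · have := (sum_eq_zero_iff_of_nonneg fun i _ => hr i).mp hz i (mem_univ i)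
      rw [hz]; simp; linarith
    · rw [mul_div_cancel_right₀ _ hz]; ring
  · have h1 : colSum (roundPlan a b F) j = colSum (scaled a b F) j
        + (∑ i', (a i' - rowSum (scaled a b F) i')) * (b j - colSum (scaled a b F) j)
          / ∑ i', (a i' - rowSum (scaled a b F) i') := by
      rw [sum_mul, sum_div, colSum, colSum, ← sum_add_distrib]
      exact sum_congr rfl fun i _ => hap i j
    rw [h1]
    by_cases hz : ∑ i', (a i' - rowSum (scaled a b F) i') = 0
    · have := (sum_eq_zero_iff_of_nonneg fun j _ => hs j).mp (heq ▸ hz) j (mem_univ j)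
      rw [hz]; simp; linarith
    · rw [mul_div_cancel_left₀ _ hz]; ring

lemma sum_abs_le_sqrt_mul_residual (a : Fin n → ℝ) (b : Fin m → ℝ)
    (F : Matrix (Fin n) (Fin m) ℝ) :
    ∑ i, |rowSum F i - a i| + ∑ j, |colSum F j - b j|
      ≤ Real.sqrt ((n : ℝ) + m) * residual a b F := by
  have h := sq_sum_le_card_mul_sum_sq (s := (univ : Finset (Fin n ⊕ Fin m)))
    (f := Sum.elim (fun i => |rowSum F i - a i|) (fun j => |colSum F j - b j|))
  simp only [Fintype.sum_sum_type, Sum.elim_inl, Sum.elim_inr, sq_abs, card_univ,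
    Fintype.card_sum, Fintype.card_fin, Nat.cast_add] at h
  rw [residual, ← Real.sqrt_mul (by positivity)]
  exact Real.le_sqrt_of_sq_le h

/-- Rounding increases the cost by at most the violation of the constraints. -/
theorem cost_roundPlan_le {C : Matrix (Fin n) (Fin m) ℝ} (hC : ∀ i j, 0 ≤ C i j)
    (ha : ∀ i, 0 ≤ a i) (hb : ∀ j, 0 ≤ b j) (hF : ∀ i j, 0 ≤ F i j)
    (hab : ∑ i, a i = ∑ j, b j) :
    cost C (roundPlan a b F)
      ≤ cost C F + Real.sqrt ((n : ℝ) + m) * supNorm C * residual a b F := by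
  have hr : ∀ i, 0 ≤ a i - rowSum (scaled a b F) i := fun i =>
    sub_nonneg.mpr (rowSum_scaled_le ha hb hF i)
  have hs : ∀ j, 0 ≤ b j - colSum (scaled a b F) j := fun j =>
    sub_nonneg.mpr (colSum_scaled_le hb j)
  have heq := sum_row_defect_eq hab (scaled a b F)
  have hle := (sum_col_defect_scaled_le ha hb hF hab).trans (sum_abs_le_sqrt_mul_residual a b F)
  have hap := roundPlan_apply ha hb hF
  set S := ∑ i', (a i' - rowSum (scaled a b F) i') with hS
  have hS0 : 0 ≤ S := sum_nonneg fun i _ => hr i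
  have h1 : cost C (roundPlan a b F) ≤ cost C (scaled a b F) + supNorm C * S := by
    have h2 : cost C (roundPlan a b F) ≤ cost C (scaled a b F)
        + ∑ i, ∑ j, supNorm C * ((a i - rowSum (scaled a b F) i)
          * (b j - colSum (scaled a b F) j) / S) := by
      unfold cost
      rw [← sum_add_distrib]
      refine sum_le_sum fun i _ => ?_
      rw [← sum_add_distrib]
      refine sum_le_sum fun j _ => ?_
      rw [hap, mul_add]
      have := mul_le_mul_of_nonneg_right (le_supNorm C i j)
        (div_nonneg (mul_nonneg (hr i) (hs j)) hS0)
      linarith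
    have h3 : ∑ i, ∑ j, supNorm C * ((a i - rowSum (scaled a b F) i)
          * (b j - colSum (scaled a b F) j) / S) = supNorm C * (S * S / S) := by
      conv_rhs => rw [show S * S = S * ∑ j, (b j - colSum (scaled a b F) j) by rw [heq]]
      simp_rw [hS, sum_mul_sum, sum_div, mul_sum]
    rw [h3, mul_self_div_self] at h2
    exact h2
  rw [← heq] at hle
  calc cost C (roundPlan a b F) ≤ cost C (scaled a b F) + supNorm C * S := h1
    _ ≤ cost C F + supNorm C * (Real.sqrt ((n : ℝ) + m) * residual a b F) :=
        add_le_add (cost_mono hC (scaled_le ha hb hF))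
          (mul_le_mul_of_nonneg_left hle (supNorm_nonneg C))
    _ = _ := by ring

end Scale

section Plans

variable {a : Fin n → ℝ} {b : Fin m → ℝ} {C X : Matrix (Fin n) (Fin m) ℝ}

lemma sum_plan (ha : a ∈ stdSimplex ℝ (Fin n)) (hX : X ∈ plans a b) : ∑ i, ∑ j, X i j = 1 := by
  rw [← sum_rowSum, hX.2.1, ha.2]

lemma plan_le_one (ha : a ∈ stdSimplex ℝ (Fin n)) (hX : X ∈ plans a b) (i : Fin n) (j : Fin m) :
    X i j ≤ 1 := by
  rw [← sum_plan ha hX]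
  exact (single_le_sum (fun j _ => hX.1 i j) (mem_univ j)).trans
    (single_le_sum (f := fun i => ∑ j, X i j) (fun i _ => sum_nonneg fun j _ => hX.1 i j)
      (mem_univ i))

lemma sum_sq_plan_le_one (ha : a ∈ stdSimplex ℝ (Fin n)) (hX : X ∈ plans a b) :
    ∑ i, ∑ j, X i j ^ 2 ≤ 1 := by
  rw [← sum_plan ha hX]
  refine sum_le_sum fun i _ => sum_le_sum fun j _ => ?_
  nlinarith [hX.1 i j, plan_le_one ha hX i j]

lemma cost_plan_le (ha : a ∈ stdSimplex ℝ (Fin n)) (hX : X ∈ plans a b) :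
    cost C X ≤ supNorm C := by
  have : cost C X ≤ ∑ i, ∑ j, supNorm C * X i j :=
    sum_le_sum fun i _ => sum_le_sum fun j _ =>
      mul_le_mul_of_nonneg_right (le_supNorm C i j) (hX.1 i j)
  simp_rw [← mul_sum] at this
  rwa [sum_plan ha hX, mul_one] at this

lemma regCost_le_cost_add {γ : ℝ} (hγ : 0 ≤ γ) (ha : a ∈ stdSimplex ℝ (Fin n))
    (hX : X ∈ plans a b) : regCost γ C X ≤ cost C X + γ / 2 := by
  have := mul_le_mul_of_nonneg_left (sum_sq_plan_le_one ha hX) (by positivity : 0 ≤ γ / 2)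
  unfold regCost
  linarith

lemma cost_le_regCost {γ : ℝ} (hγ : 0 ≤ γ) : cost C X ≤ regCost γ C X := by
  have : 0 ≤ γ / 2 * ∑ i, ∑ j, X i j ^ 2 := by positivity
  unfold regCost
  linarith

/-- Weak duality for the Euclidean-regularised problem. -/
theorem dual_le_regCost {γ : ℝ} (hγ : 0 < γ) (hX : X ∈ plans a b) (lam : Fin n → ℝ)
    (mu : Fin m → ℝ) : dual γ C a b lam mu ≤ regCost γ C X := by
  have hent : ∀ i j, -(1 / (2 * γ)) * (max 0 (-C i j - lam i - mu j)) ^ 2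
      - (lam i * X i j + mu j * X i j) ≤ C i j * X i j + γ / 2 * X i j ^ 2 := by
    intro i j
    have hx := hX.1 i j
    -- Entrywise Fenchel–Young inequality, obtained from the square of `max 0 t - γ * X i j`.
    set t := -C i j - lam i - mu j with ht
    have h1 : t * X i j ≤ max 0 t * X i j := mul_le_mul_of_nonneg_right (le_max_right _ _) hx
    have h2 : 0 ≤ 1 / (2 * γ) * (max 0 t - γ * X i j) ^ 2 := by positivity
    have h3 : 1 / (2 * γ) * (max 0 t - γ * X i j) ^ 2
        = 1 / (2 * γ) * (max 0 t) ^ 2 - max 0 t * X i j + γ / 2 * X i j ^ 2 := by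
      field_simp
      ring
    have h4 : C i j * X i j = -(t * X i j) - (lam i * X i j + mu j * X i j) := by rw [ht]; ring
    linarith
  have hsum := sum_le_sum fun i (_ : i ∈ univ) => sum_le_sum fun j (_ : j ∈ univ) => hent i j
  simp only [sum_sub_distrib, sum_add_distrib, ← mul_sum] at hsum
  have hl : ∑ i, lam i * a i = ∑ i, lam i * ∑ j, X i j := by rw [← hX.2.1]; rfl
  have hm : ∑ j, mu j * b j = ∑ i, ∑ j, mu j * X i j := by
    rw [sum_comm, ← hX.2.2]
    exact sum_congr rfl fun j _ => by rw [colSum, mul_sum]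
  unfold dual regCost cost
  rw [hl, hm, sum_comm]
  linarith

theorem exists_isOptimalPlan (C : Matrix (Fin n) (Fin m) ℝ) (ha : a ∈ stdSimplex ℝ (Fin n))
    (hb : b ∈ stdSimplex ℝ (Fin m)) : ∃ X, IsOptimalPlan C a b X := by
  have hne : (plans a b).Nonempty := by
    refine ⟨fun i j => a i * b j, fun i j => mul_nonneg (ha.1 i) (hb.1 j), funext fun i => ?_,
      funext fun j => ?_⟩
    · simp only [rowSum]; rw [← mul_sum, hb.2, mul_one]
    · simp only [colSum]; rw [← sum_mul, ha.2, one_mul]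
  have hbox : IsCompact (Set.univ.pi fun _ : Fin n => Set.univ.pi fun _ : Fin m =>
      Set.Icc (0 : ℝ) 1) :=
    isCompact_univ_pi fun _ => isCompact_univ_pi fun _ => isCompact_Icc
  have hentry : ∀ i j, Continuous fun X : Fin n → Fin m → ℝ => X i j := fun i j => by fun_prop
  have hclosed : IsClosed {X : Fin n → Fin m → ℝ | (∀ i j, 0 ≤ X i j) ∧
      (fun i => ∑ j, X i j) = a ∧ (fun j => ∑ i, X i j) = b} := by
    have hnonneg : IsClosed {X : Fin n → Fin m → ℝ | ∀ i j, 0 ≤ X i j} := by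
      have : {X : Fin n → Fin m → ℝ | ∀ i j, 0 ≤ X i j}
          = ⋂ i, ⋂ j, {X : Fin n → Fin m → ℝ | 0 ≤ X i j} := by ext; simp
      rw [this]
      exact isClosed_iInter fun i => isClosed_iInter fun j =>
        isClosed_le continuous_const (hentry i j)
    refine hnonneg.inter (IsClosed.inter ?_ ?_)
    · exact isClosed_eq (by fun_prop) continuous_const
    · exact isClosed_eq (by fun_prop) continuous_const
  have hcomp : IsCompact {X : Fin n → Fin m → ℝ | (∀ i j, 0 ≤ X i j) ∧
      (fun i => ∑ j, X i j) = a ∧ (fun j => ∑ i, X i j) = b} :=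
    hbox.of_isClosed_subset hclosed fun X hX i _ j _ =>
      ⟨hX.1 i j, plan_le_one (X := X) (b := b) ha hX i j⟩
  have hcont : Continuous fun X : Fin n → Fin m → ℝ => ∑ i, ∑ j, C i j * X i j := by fun_prop
  obtain ⟨X, hX, hmin⟩ := hcomp.exists_isMinOn hne hcont.continuousOn
  exact ⟨X, hX, hmin⟩

end Plans

end Rounding

/-! ### Abel summation for the change of weights -/

section Reweighting

open Finset

lemma sum_range_by_partial_sums {M : Type*} [AddCommGroup M] [Module ℝ M] (ρ : ℕ → ℝ) (v : ℕ → M)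
    (k : ℕ) : ∑ i ∈ range (k + 1), ρ i • v i
      = ∑ j ∈ range k, (ρ j - ρ (j + 1)) • (∑ i ∈ range (j + 1), v i)
        + ρ k • ∑ i ∈ range (k + 1), v i := by
  induction k with
  | zero => simp
  | succ k ih =>
    rw [sum_range_succ, ih, sum_range_succ (fun j => (ρ j - ρ (j + 1)) • _) k,
      sum_range_succ v (k + 1), sub_smul, smul_add]
    abel

lemma sum_range_ite_lt_three_le (k : ℕ) {r : ℝ} (hr : 0 ≤ r) :
    ∑ j ∈ range k, (if j < 3 then r else 0) ≤ 3 * r := by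
  have h : ∀ k, ∑ j ∈ range (k + 3), (if j < 3 then r else 0) = 3 * r := by
    intro k
    induction k with
    | zero => simp [sum_range_succ]; ring
    | succ k ih => rw [show k + 1 + 3 = (k + 3) + 1 by ring, sum_range_succ, ih, if_neg (by omega),
        add_zero]
  rw [← h k]
  exact sum_le_sum_of_subset_of_nonneg (range_mono (by omega)) fun j _ _ => by
    split_ifs <;> simp [hr]

/-- The weights given to the partial sums when the terms are multiplied by `ρ`. -/
def partialWeight (ρ : ℕ → ℝ) (k j : ℕ) : ℝ := if j < k then |ρ j - ρ (j + 1)| else ρ k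

lemma sum_partialWeight_mul (ρ : ℕ → ℝ) (k : ℕ) (β : ℕ → ℝ) :
    ∑ j ∈ range (k + 1), partialWeight ρ k j * β j
      = ∑ j ∈ range k, |ρ j - ρ (j + 1)| * β j + ρ k * β k := by
  rw [sum_range_succ, partialWeight, if_neg (lt_irrefl k)]
  congr 1
  exact sum_congr rfl fun j hj => by rw [partialWeight, if_pos (mem_range.mp hj)]

variable {ρ : ℕ → ℝ}

lemma sum_partialWeight_le (h0 : ∀ j, 0 ≤ ρ j) (h2 : ∀ j, ρ j ≤ 2)
    (hanti : ∀ j, 3 ≤ j → ρ (j + 1) ≤ ρ j) (k : ℕ) :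
    ∑ j ∈ range (k + 1), partialWeight ρ k j ≤ 14 := by
  have h := sum_partialWeight_mul ρ k fun _ => 1
  simp only [mul_one] at h
  -- Only the first three differences may be negative, and each is at least `-2`, so the absolute
  -- values telescope up to `3 · 4`; adding `ρ 0 ≤ 2` gives `14`.
  have hj : ∀ j, |ρ j - ρ (j + 1)| ≤ (ρ j - ρ (j + 1)) + if j < 3 then 4 else 0 := by
    intro j
    split_ifs with h3
    · rcases abs_cases (ρ j - ρ (j + 1)) with h | h
      · linarith
      · linarith [h0 j, h2 (j + 1)]
    · rw [abs_of_nonneg (by linarith [hanti j (by omega)])]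
      linarith
  have hs := sum_le_sum fun j (_ : j ∈ range k) => hj j
  rw [sum_add_distrib, sum_range_sub'] at hs
  rw [h]
  linarith [sum_range_ite_lt_three_le k (by norm_num : (0 : ℝ) ≤ 4), h2 0]

/-- Bounds on the partial sums carry over to the sums reweighted by a bounded sequence that is
antitone up to its first three terms. -/
lemma reweighted_le {H : Type*} [NormedAddCommGroup H] [NormedSpace ℝ H] (h0 : ∀ j, 0 ≤ ρ j)
    (h2 : ∀ j, ρ j ≤ 2) (hanti : ∀ j, 3 ≤ j → ρ (j + 1) ≤ ρ j) (d : ℕ → ℝ) (v : ℕ → H)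
    (β : ℕ → ℝ) {R S : ℝ} (hR : 0 ≤ R) (hS : 0 ≤ S)
    (hβ : ∀ j, ∑ i ∈ range (j + 1), d i + R * ‖∑ i ∈ range (j + 1), v i‖ ≤ β j)
    (hlow : ∀ j, j < 3 → -S ≤ ∑ i ∈ range (j + 1), d i) (k : ℕ) :
    ∑ i ∈ range (k + 1), ρ i * d i + R * ‖∑ i ∈ range (k + 1), ρ i • v i‖
      ≤ ∑ j ∈ range (k + 1), partialWeight ρ k j * β j + 12 * S := by
  have e1 := sum_range_by_partial_sums ρ d k
  simp only [smul_eq_mul] at e1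
  rw [e1, sum_range_by_partial_sums ρ v k, sum_partialWeight_mul]
  set Φ := fun j => ∑ i ∈ range (j + 1), d i with hΦ
  set G := fun j => ∑ i ∈ range (j + 1), v i with hG
  have hn : ‖∑ j ∈ range k, (ρ j - ρ (j + 1)) • G j + ρ k • G k‖
      ≤ ∑ j ∈ range k, |ρ j - ρ (j + 1)| * ‖G j‖ + ρ k * ‖G k‖ := by
    refine (norm_add_le _ _).trans (add_le_add ((norm_sum_le _ _).trans ?_) ?_)
    · exact le_of_eq (sum_congr rfl fun j _ => by rw [norm_smul, Real.norm_eq_abs])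
    · rw [norm_smul, Real.norm_eq_abs, abs_of_nonneg (h0 k)]
  -- Where `ρ` increases, the gap enters with the wrong sign. Reversing it costs `2 |ρ j - ρ (j +
  -- 1)| S ≤ 4 S`, at no more than three indices.
  have hj : ∀ j, (ρ j - ρ (j + 1)) * Φ j + R * (|ρ j - ρ (j + 1)| * ‖G j‖)
      ≤ |ρ j - ρ (j + 1)| * β j + if j < 3 then 4 * S else 0 := by
    intro j
    have hb : Φ j + R * ‖G j‖ ≤ β j := hβ j
    rcases le_or_gt 0 (ρ j - ρ (j + 1)) with hc | hc
    · rw [abs_of_nonneg hc]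
      have := mul_le_mul_of_nonneg_left hb hc
      have : (0 : ℝ) ≤ if j < 3 then 4 * S else 0 := by split_ifs <;> positivity
      linarith
    · have h3 : j < 3 := by
        by_contra h3
        linarith [hanti j (by omega)]
      rw [abs_of_neg hc, if_pos h3]
      have hl : -S ≤ Φ j := hlow j h3
      have e2 := mul_le_mul_of_nonneg_left hb (neg_nonneg.mpr hc.le)
      have e3 := mul_le_mul_of_nonneg_left hl (neg_nonneg.mpr hc.le)
      have e4 : -(ρ j - ρ (j + 1)) * S ≤ 2 * S := by
        gcongr
        linarith [h0 j, h2 (j + 1)]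
      linarith
  have hs := sum_le_sum fun j (_ : j ∈ range k) => hj j
  rw [sum_add_distrib, sum_add_distrib, ← mul_sum] at hs
  have hl := mul_le_mul_of_nonneg_left (hβ k) (h0 k)
  have hR' := mul_le_mul_of_nonneg_left hn hR
  have h12 := sum_range_ite_lt_three_le k (by positivity : (0 : ℝ) ≤ 4 * S)
  simp only [hΦ, hG] at *
  linarith

end Reweighting

/-! ### Matrices and dual variables as Euclidean vectors -/

section Vectorised

open Finset
open scoped InnerProductSpace

variable {n m : ℕ}

/-- A matrix as a vector of a Euclidean space. -/
def vec (X : Matrix (Fin n) (Fin m) ℝ) : EuclideanSpace ℝ (Fin n × Fin m) :=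
  WithLp.toLp 2 fun p => X p.1 p.2

/-- A pair of dual variables as a vector of a Euclidean space. -/
def dualVec (lam : Fin n → ℝ) (mu : Fin m → ℝ) : EuclideanSpace ℝ (Fin n ⊕ Fin m) :=
  WithLp.toLp 2 (Sum.elim lam mu)

/-- The linear map `X ↦ (X 1_m, Xᵀ 1_n)`. -/
def marginals (n m : ℕ) :
    EuclideanSpace ℝ (Fin n × Fin m) →ₗ[ℝ] EuclideanSpace ℝ (Fin n ⊕ Fin m) where
  toFun u := dualVec (fun i => ∑ j, u (i, j)) (fun j => ∑ i, u (i, j))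
  map_add' u v := by
    ext p
    rcases p with i | j <;> simp [dualVec, sum_add_distrib]
  map_smul' r u := by
    ext p
    rcases p with i | j <;> simp [dualVec, mul_sum]

/-- The reflection `(λ, μ) ↦ (-λ, μ)`. -/
def blockReflection (n m : ℕ) :
    EuclideanSpace ℝ (Fin n ⊕ Fin m) →ₗ[ℝ] EuclideanSpace ℝ (Fin n ⊕ Fin m) where
  toFun u := dualVec (fun i => -u (Sum.inl i)) (fun j => u (Sum.inr j))
  map_add' u v := by
    ext p
    rcases p with i | j <;> simp [dualVec]
    ring
  map_smul' r u := by
    ext p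
    rcases p with i | j <;> simp [dualVec]

@[simp] lemma vec_apply (X : Matrix (Fin n) (Fin m) ℝ) (p : Fin n × Fin m) :
    vec X p = X p.1 p.2 := rfl

@[simp] lemma dualVec_inl (lam : Fin n → ℝ) (mu : Fin m → ℝ) (i : Fin n) :
    dualVec lam mu (Sum.inl i) = lam i := rfl

@[simp] lemma dualVec_inr (lam : Fin n → ℝ) (mu : Fin m → ℝ) (j : Fin m) :
    dualVec lam mu (Sum.inr j) = mu j := rfl

@[simp] lemma marginals_inl (u : EuclideanSpace ℝ (Fin n × Fin m)) (i : Fin n) :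
    marginals n m u (Sum.inl i) = ∑ j, u (i, j) := rfl

@[simp] lemma marginals_inr (u : EuclideanSpace ℝ (Fin n × Fin m)) (j : Fin m) :
    marginals n m u (Sum.inr j) = ∑ i, u (i, j) := rfl

@[simp] lemma blockReflection_inl (u : EuclideanSpace ℝ (Fin n ⊕ Fin m)) (i : Fin n) :
    blockReflection n m u (Sum.inl i) = -u (Sum.inl i) := rfl

@[simp] lemma blockReflection_inr (u : EuclideanSpace ℝ (Fin n ⊕ Fin m)) (j : Fin m) :
    blockReflection n m u (Sum.inr j) = u (Sum.inr j) := rfl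

lemma inner_matrix (u v : EuclideanSpace ℝ (Fin n × Fin m)) :
    ⟪u, v⟫_ℝ = ∑ i, ∑ j, u (i, j) * v (i, j) := by
  rw [PiLp.inner_apply, Fintype.sum_prod_type]
  simp [mul_comm]

lemma inner_blocks (u v : EuclideanSpace ℝ (Fin n ⊕ Fin m)) :
    ⟪u, v⟫_ℝ = ∑ i, u (Sum.inl i) * v (Sum.inl i) + ∑ j, u (Sum.inr j) * v (Sum.inr j) := by
  rw [PiLp.inner_apply, Fintype.sum_sum_type]
  simp [mul_comm]

lemma norm_sq_matrix (u : EuclideanSpace ℝ (Fin n × Fin m)) :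
    ‖u‖ ^ 2 = ∑ i, ∑ j, u (i, j) ^ 2 := by
  rw [← real_inner_self_eq_norm_sq, inner_matrix]
  simp [sq]

lemma norm_sq_blocks (u : EuclideanSpace ℝ (Fin n ⊕ Fin m)) :
    ‖u‖ ^ 2 = ∑ i, u (Sum.inl i) ^ 2 + ∑ j, u (Sum.inr j) ^ 2 := by
  rw [← real_inner_self_eq_norm_sq, inner_blocks]
  simp [sq]

lemma inner_vec_eq_cost (C X : Matrix (Fin n) (Fin m) ℝ) : ⟪vec C, vec X⟫_ℝ = cost C X := by
  rw [inner_matrix]; rfl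

lemma regObj_vec (γ : ℝ) (C X : Matrix (Fin n) (Fin m) ℝ) :
    regObj γ (vec C) (vec X) = regCost γ C X := by
  rw [regObj, inner_vec_eq_cost, norm_sq_matrix]; rfl

lemma marginals_vec (X : Matrix (Fin n) (Fin m) ℝ) :
    marginals n m (vec X) = dualVec (rowSum X) (colSum X) := rfl

/-- The adjoint of the map to the marginals. -/
lemma inner_dualVec_marginals (lam : Fin n → ℝ) (mu : Fin m → ℝ)
    (u : EuclideanSpace ℝ (Fin n × Fin m)) :
    ⟪dualVec lam mu, marginals n m u⟫_ℝ = ∑ i, ∑ j, (lam i + mu j) * u (i, j) := by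
  rw [inner_blocks]
  simp only [dualVec_inl, dualVec_inr, marginals_inl, marginals_inr, add_mul, sum_add_distrib,
    mul_sum]
  congr 1
  exact sum_comm

lemma residual_eq_norm {a : Fin n → ℝ} {b : Fin m → ℝ} (X : Matrix (Fin n) (Fin m) ℝ) :
    residual a b X = ‖marginals n m (vec X) - dualVec a b‖ := by
  rw [residual, ← Real.sqrt_sq (norm_nonneg _), norm_sq_blocks]
  rfl

lemma block_bound_of_sign {σ : ℝ} (hσ : σ = 1 ∨ σ = -1) (u : EuclideanSpace ℝ (Fin n × Fin m)) :
    ‖marginals n m u - σ • blockReflection n m (marginals n m u)‖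
      ≤ 2 * Real.sqrt ((n : ℝ) + m) * ‖u‖ := by
  refine (sq_le_sq₀ (norm_nonneg _) (by positivity)).mp ?_
  rw [mul_pow, mul_pow, Real.sq_sqrt (by positivity), norm_sq_blocks, norm_sq_matrix]
  have hrow : ∑ i, (∑ j, u (i, j)) ^ 2 ≤ m * ∑ i, ∑ j, u (i, j) ^ 2 := by
    rw [mul_sum]
    refine sum_le_sum fun i _ => ?_
    simpa using sq_sum_le_card_mul_sum_sq (s := (univ : Finset (Fin m))) (f := fun j => u (i, j))
  have hcol : ∑ j, (∑ i, u (i, j)) ^ 2 ≤ n * ∑ i, ∑ j, u (i, j) ^ 2 := by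
    rw [sum_comm, mul_sum]
    refine sum_le_sum fun j _ => ?_
    simpa using sq_sum_le_card_mul_sum_sq (s := (univ : Finset (Fin n))) (f := fun i => u (i, j))
  have hpos : 0 ≤ ∑ i, ∑ j, u (i, j) ^ 2 := by positivity
  have hn : (0 : ℝ) ≤ n := by positivity
  have hm : (0 : ℝ) ≤ m := by positivity
  have e1 : ∀ r : ℝ, (r + r) ^ 2 = 4 * r ^ 2 := fun r => by ring
  rcases hσ with rfl | rfl
  · simp [e1, ← mul_sum]
    nlinarith
  · simp [e1, ← mul_sum]
    nlinarith

/-- For nonnegative matrices the inner product is nonnegative, so the cross term can be dropped. -/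
lemma norm_vec_sub_sq_le {U V : Matrix (Fin n) (Fin m) ℝ} (hU : ∀ i j, 0 ≤ U i j)
    (hV : ∀ i j, 0 ≤ V i j) (hU1 : ∑ i, ∑ j, U i j ^ 2 ≤ 1) (hV1 : ∑ i, ∑ j, V i j ^ 2 ≤ 1) :
    ‖vec U - vec V‖ ^ 2 ≤ 2 := by
  have h1 : 0 ≤ ⟪vec U, vec V⟫_ℝ := by
    rw [inner_vec_eq_cost]; exact cost_nonneg hU hV
  have h2 : ‖vec U‖ ^ 2 ≤ 1 := by rw [norm_sq_matrix]; exact hU1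
  have h3 : ‖vec V‖ ^ 2 ≤ 1 := by rw [norm_sq_matrix]; exact hV1
  rw [norm_sub_sq_real]
  linarith

/-- The projected prox step minimises the prox objective over the nonnegative matrices, with
quadratic growth. -/
lemma proxObj_projected_le {γ B : ℝ} (hγ : 0 < γ) (hB : 0 ≤ B) (Q X₀ X Y : Matrix (Fin n) (Fin m) ℝ)
    (hX : ∀ i j, X i j = max 0 (γ * X₀ i j - Q i j) / (γ + γ * B)) (hY : ∀ i j, 0 ≤ Y i j) :
    proxObj γ B (vec Q) (vec X₀) (vec X) + γ * (1 + B) / 2 * ‖vec Y - vec X‖ ^ 2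
      ≤ proxObj γ B (vec Q) (vec X₀) (vec Y) := by
  unfold proxObj
  simp only [inner_matrix, norm_sq_matrix, mul_sum, ← sum_add_distrib, vec_apply,
    WithLp.ofLp_sub, Pi.sub_apply]
  refine sum_le_sum fun i _ => sum_le_sum fun j _ => ?_
  have hpos : 0 < γ + γ * B := by positivity
  set s := X i j with hs
  set t := Y i j
  set w := γ * X₀ i j - Q i j with hw
  have h1 : s * (γ + γ * B) = max 0 w := by rw [hs, hX, div_mul_cancel₀ _ hpos.ne']
  -- The variational inequality of projection onto the half-line. The objective separates over
  -- entries and is quadratic with curvature `γ * (1 + B)`, so this gives the quadratic growth.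
  have h2 : 0 ≤ (t - s) * (s * (γ + γ * B) - w) := by
    rw [h1]
    rcases le_total w 0 with h | h
    · have : s = 0 := by rw [hs, hX, max_eq_left h, zero_div]
      rw [this, max_eq_left h]
      have := hY i j
      nlinarith
    · rw [max_eq_right h]; simp
  rw [hw] at h2
  nlinarith

end Vectorised

/-! ### The method as an instance of the abstract run -/

section Run

open Finset
open scoped InnerProductSpace

variable {n m : ℕ}

lemma one_le_of_mem_stdSimplex {a : Fin n → ℝ} (ha : a ∈ stdSimplex ℝ (Fin n)) : 1 ≤ n := by
  rcases n with _ | n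
  · have := ha.2
    simp at this
  · omega

/-- The sign of the block that is updated with the random number `t`. -/
def blockSign (t : ℝ) : ℝ := if t < 1 / 2 then 1 else -1

lemma blockSign_eq (t : ℝ) : blockSign t = 1 ∨ blockSign t = -1 := by
  unfold blockSign
  split_ifs <;> simp

variable {γ : ℝ} {C : Matrix (Fin n) (Fin m) ℝ} {a : Fin n → ℝ} {b : Fin m → ℝ}

lemma step_weight_eq (hγ : γ ≠ 0) (ξ : ℕ → ℝ) (k : ℕ) :
    (clvrState γ γ C a b ξ k).step = stepSize ((n : ℝ) + m) k ∧
      (clvrState γ γ C a b ξ k).weight = totalWeight ((n : ℝ) + m) k := by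
  induction k with
  | zero => exact ⟨rfl, rfl⟩
  | succ k ih =>
    refine ⟨?_, ?_⟩
    · change 1 / 4 * Real.sqrt ((1 + γ * (clvrState γ γ C a b ξ k).weight / γ) / _) = _
      rw [ih.2, mul_div_cancel_left₀ _ hγ]
      rfl
    · change (clvrState γ γ C a b ξ k).weight + (clvrState γ γ C a b ξ k).step = _
      rw [ih.1, ih.2]
      rfl

lemma z_eq (α γ : ℝ) (ξ : ℕ → ℝ) (k : ℕ) (i : Fin n) (j : Fin m) :
    (clvrState α γ C a b ξ k).z i j
      = (clvrState α γ C a b ξ k).lam i + (clvrState α γ C a b ξ k).mu j := by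
  induction k with
  | zero => simp [clvrState, clvrInit]
  | succ k ih =>
    simp only [clvrState, clvrStep]
    split_ifs <;> rw [ih] <;> ring

lemma clvrPrimal_nonneg (hγ : 0 < γ) (ξ : ℕ → ℝ) (k : ℕ) (i : Fin n) (j : Fin m) :
    0 ≤ clvrPrimal γ γ (clvrState γ γ C a b ξ k) i j := by
  obtain ⟨h1, h2⟩ := step_weight_eq (C := C) (a := a) (b := b) hγ.ne' ξ k
  have := stepSize_nonneg ((n : ℝ) + m) k
  have := totalWeight_nonneg ((n : ℝ) + m) k
  unfold clvrPrimal
  rw [h1, h2]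
  positivity

lemma sumX_eq (hγ : γ ≠ 0) (ξ : ℕ → ℝ) (k : ℕ) :
    (clvrState γ γ C a b ξ k).sumX = ∑ i ∈ range k,
      stepSize ((n : ℝ) + m) (i + 1) • clvrPrimal γ γ (clvrState γ γ C a b ξ i) := by
  induction k with
  | zero => rfl
  | succ k ih =>
    rw [sum_range_succ, ← ih, ← (step_weight_eq hγ ξ (k + 1)).1]
    rfl

lemma avg_nonneg (hγ : 0 < γ) (ξ : ℕ → ℝ) (k : ℕ) (i : Fin n) (j : Fin m) :
    0 ≤ (clvrState γ γ C a b ξ k).avg i j := by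
  unfold CLVRState.avg
  rw [sumX_eq hγ.ne', (step_weight_eq hγ.ne' ξ k).2]
  rw [Matrix.smul_apply, Matrix.sum_apply, smul_eq_mul]
  refine mul_nonneg (div_nonneg zero_le_one (totalWeight_nonneg _ _)) (sum_nonneg fun l _ => ?_)
  rw [Matrix.smul_apply, smul_eq_mul]
  exact mul_nonneg (stepSize_nonneg _ _) (clvrPrimal_nonneg hγ ξ l i j)

lemma sum_sq_le_one_of_le (hn : 1 ≤ n) (hm : 1 ≤ m) {X : Matrix (Fin n) (Fin m) ℝ}
    (hX : ∀ i j, 0 ≤ X i j) (hle : ∀ i j, X i j ≤ 1 / ((n : ℝ) * m)) :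
    ∑ i, ∑ j, X i j ^ 2 ≤ 1 := by
  have hn' : (1 : ℝ) ≤ n := by exact_mod_cast hn
  have hm' : (1 : ℝ) ≤ m := by exact_mod_cast hm
  have h1 : ∑ i, ∑ j, X i j ^ 2 ≤ ∑ _i : Fin n, ∑ _j : Fin m, (1 / ((n : ℝ) * m)) ^ 2 :=
    sum_le_sum fun i _ => sum_le_sum fun j _ => pow_le_pow_left₀ (hX i j) (hle i j) 2
  refine h1.trans ?_
  simp only [sum_const, card_univ, Fintype.card_fin, nsmul_eq_mul]
  have : (n : ℝ) * (m * (1 / ((n : ℝ) * m)) ^ 2) = 1 / ((n : ℝ) * m) := by field_simp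
  rw [this, div_le_one (by positivity)]
  nlinarith

/-- Nonnegative costs only lower the first iterate below the uniform matrix. This keeps its distance
to any plan bounded independently of `C`. -/
lemma clvrPrimal_zero_le (hγ : 0 < γ) (hC : ∀ i j, 0 ≤ C i j) (ξ : ℕ → ℝ) (i : Fin n)
    (j : Fin m) : clvrPrimal γ γ (clvrState γ γ C a b ξ 0) i j ≤ 1 / ((n : ℝ) * m) := by
  have h0 : 0 ≤ 1 / (2 * Real.sqrt ((n : ℝ) + m)) := by positivity
  change max 0 (γ * (1 / ((n : ℝ) * m)) - 1 / (2 * Real.sqrt ((n : ℝ) + m)) * C i j)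
    / (γ + γ * (1 / (2 * Real.sqrt ((n : ℝ) + m)) + 1 / (2 * Real.sqrt ((n : ℝ) + m)))) ≤ _
  set r := 1 / (2 * Real.sqrt ((n : ℝ) + m))
  have hnm : 0 ≤ 1 / ((n : ℝ) * m) := by positivity
  rw [div_le_iff₀ (by positivity)]
  refine max_le (by positivity) ?_
  have := mul_nonneg h0 (hC i j)
  have : 0 ≤ 1 / ((n : ℝ) * m) * (γ * (r + r)) := by positivity
  linarith

/-- Every path of the method with equal proximal and regularisation parameters is a coordinate
run. -/
theorem coordinateRun (hγ : 0 < γ) (hC : ∀ i j, 0 ≤ C i j) (ha : a ∈ stdSimplex ℝ (Fin n))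
    (hb : b ∈ stdSimplex ℝ (Fin m)) {Xs : Matrix (Fin n) (Fin m) ℝ} (hXs : Xs ∈ plans a b)
    (ξ : ℕ → ℝ) :
    CoordinateRun (marginals n m) (blockReflection n m) (vec C) (vec fun _ _ => 1 / ((n : ℝ) * m))
      (vec Xs) γ ((n : ℝ) + m) (stepSize ((n : ℝ) + m)) (fun k => blockSign (ξ k))
      (fun k => vec (clvrPrimal γ γ (clvrState γ γ C a b ξ k)))
      (fun k => vec (clvrState γ γ C a b ξ k).q)
      (fun k => dualVec (clvrState γ γ C a b ξ k).lam (clvrState γ γ C a b ξ k).mu) := by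
  have hn := one_le_of_mem_stdSimplex ha
  have hm := one_le_of_mem_stdSimplex hb
  have hN : (2 : ℝ) ≤ (n : ℝ) + m := by
    have hn' : (1 : ℝ) ≤ n := by exact_mod_cast hn
    have hm' : (1 : ℝ) ≤ m := by exact_mod_cast hm
    linarith
  have hN0 : (0 : ℝ) < (n : ℝ) + m := by linarith
  have hst := fun k => step_weight_eq (C := C) (a := a) (b := b) hγ.ne' ξ k
  have hprox : ∀ k (Y : Matrix (Fin n) (Fin m) ℝ), (∀ i j, 0 ≤ Y i j) →
      proxObj γ (stepSize ((n : ℝ) + m) 0 + ∑ i ∈ range (k + 1), stepSize ((n : ℝ) + m) i)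
        (vec (clvrState γ γ C a b ξ k).q) (vec fun _ _ => 1 / ((n : ℝ) * m))
        (vec (clvrPrimal γ γ (clvrState γ γ C a b ξ k)))
      + γ * (1 + (stepSize ((n : ℝ) + m) 0 + ∑ i ∈ range (k + 1), stepSize ((n : ℝ) + m) i)) / 2
        * ‖vec Y - vec (clvrPrimal γ γ (clvrState γ γ C a b ξ k))‖ ^ 2
      ≤ proxObj γ (stepSize ((n : ℝ) + m) 0 + ∑ i ∈ range (k + 1), stepSize ((n : ℝ) + m) i)
        (vec (clvrState γ γ C a b ξ k).q) (vec fun _ _ => 1 / ((n : ℝ) * m)) (vec Y) := by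
    intro k Y hY
    rw [← totalWeight_eq_sum]
    refine proxObj_projected_le hγ (totalWeight_nonneg _ _) _ _ _ _ (fun i j => ?_) hY
    rw [totalWeight_succ, ← (hst k).1, ← (hst k).2]
    rfl
  refine
    { γ_pos := hγ
      N_nonneg := hN0.le
      J_symm := fun u v => ?_
      J_invol := fun u => ?_
      sign := fun k => blockSign_eq _
      block_bound := fun k u => block_bound_of_sign (blockSign_eq _) u
      a_pos := stepSize_pos hN0
      a_zero_le := (stepSize_zero_le hN).trans (by norm_num)
      a_zero_sq := (stepSize_zero_sq hN0).le
      a_succ_sq := fun k => ?_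
      xs_norm := ?_
      xs_sub := ?_
      x_zero := ?_
      y_zero := ?_
      y_succ := fun k => ?_
      q_zero := ?_
      q_succ := fun k u => ?_
      opt_xs := fun k => hprox k Xs hXs.1
      opt_succ := fun k => hprox k _ (clvrPrimal_nonneg hγ ξ (k + 1)) }
  · simp [inner_blocks]
  · ext p
    rcases p with i | j <;> simp
  -- The recursion attains `1 + A_k`, while the abstract condition asks only for the later weight
  -- `A_{k+2}`.
  · rw [stepSize_succ_sq hN0, ← totalWeight_eq_sum]
    linarith [totalWeight_mono ((n : ℝ) + m) (by omega : k ≤ k + 2)]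
  · rw [norm_sq_matrix]
    exact sum_sq_plan_le_one ha hXs
  · exact norm_vec_sub_sq_le hXs.1 (fun _ _ => by positivity) (sum_sq_plan_le_one ha hXs)
      (sum_sq_le_one_of_le hn hm (fun _ _ => by positivity) fun _ _ => le_rfl)
  · exact norm_vec_sub_sq_le (clvrPrimal_nonneg hγ ξ 0) hXs.1
      (sum_sq_le_one_of_le hn hm (clvrPrimal_nonneg hγ ξ 0) (clvrPrimal_zero_le hγ hC ξ))
      (sum_sq_plan_le_one ha hXs)
  · ext p
    rcases p with i | j <;> rfl
  · have hrow : ∀ i, ∑ j, (clvrPrimal γ γ (clvrState γ γ C a b ξ k) i j - Xs i j)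
        = rowSum (clvrPrimal γ γ (clvrState γ γ C a b ξ k)) i - a i := fun i => by
      rw [sum_sub_distrib, ← hXs.2.1]; rfl
    have hcol : ∀ j, ∑ i, (clvrPrimal γ γ (clvrState γ γ C a b ξ k) i j - Xs i j)
        = colSum (clvrPrimal γ γ (clvrState γ γ C a b ξ k)) j - b j := fun j => by
      rw [sum_sub_distrib, ← hXs.2.2]; rfl
    ext p
    rcases p with i | j
    · simp only [dualVec_inl, PiLp.add_apply, PiLp.sub_apply, PiLp.smul_apply, marginals_inl,
        blockReflection_inl, vec_apply, smul_eq_mul, hrow, blockSign]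
      simp only [clvrState, clvrStep]
      rw [(hst k).1]
      split_ifs <;> ring
    · simp only [dualVec_inr, PiLp.add_apply, PiLp.sub_apply, PiLp.smul_apply, marginals_inr,
        blockReflection_inr, vec_apply, smul_eq_mul, hcol, blockSign]
      simp only [clvrState, clvrStep]
      rw [(hst k).1]
      split_ifs <;> ring
  · ext p
    rfl
  · have hsub : ∀ (l l' : Fin n → ℝ) (r r' : Fin m → ℝ),
        dualVec l r - dualVec l' r' = dualVec (l - l') (r - r') := by
      intro l l' r r'
      ext p
      rcases p with i | j <;> rfl
    have hq : ∀ i j, (clvrState γ γ C a b ξ (k + 1)).q i j = (clvrState γ γ C a b ξ k).q i j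
        + stepSize ((n : ℝ) + m) (k + 1) * ((clvrState γ γ C a b ξ (k + 1)).z i j + C i j)
        + 2 * stepSize ((n : ℝ) + m) k
          * ((clvrState γ γ C a b ξ (k + 1)).z i j - (clvrState γ γ C a b ξ k).z i j) := by
      intro i j
      rw [← (hst k).1, ← (hst (k + 1)).1]
      rfl
    rw [hsub, inner_dualVec_marginals, inner_dualVec_marginals, inner_matrix, inner_matrix,
      inner_matrix, ← sum_add_distrib, mul_sum, mul_sum, ← sum_add_distrib, ← sum_add_distrib]
    refine sum_congr rfl fun i _ => ?_
    rw [← sum_add_distrib, mul_sum, mul_sum, ← sum_add_distrib, ← sum_add_distrib]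
    refine sum_congr rfl fun j _ => ?_
    simp only [vec_apply, hq, z_eq, Pi.sub_apply]
    ring

end Run

/-! ### Cost and residual of the averaged iterate -/

section Average

open Finset
open scoped InnerProductSpace

variable {n m : ℕ} {γ : ℝ} {C : Matrix (Fin n) (Fin m) ℝ} {a : Fin n → ℝ} {b : Fin m → ℝ}

lemma two_le_add_of_mem_stdSimplex (ha : a ∈ stdSimplex ℝ (Fin n))
    (hb : b ∈ stdSimplex ℝ (Fin m)) : (2 : ℝ) ≤ (n : ℝ) + m := by
  have hn : (1 : ℝ) ≤ n := by exact_mod_cast one_le_of_mem_stdSimplex ha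
  have hm : (1 : ℝ) ≤ m := by exact_mod_cast one_le_of_mem_stdSimplex hb
  linarith

lemma sum_stepSize_le_of_lt_three {N : ℝ} (hN : 2 ≤ N) {j : ℕ} (hj : j < 3) :
    ∑ i ∈ range (j + 1), stepSize N i ≤ 3 / 2 := by
  have hN0 : 0 < N := by linarith
  have h0 := stepSize_zero_le hN
  have half : ∀ k, totalWeight N k ≤ 1 → stepSize N (k + 1) ≤ 1 / 2 := by
    intro k hk
    refine (sq_le_sq₀ (stepSize_nonneg N _) (by norm_num)).mp ?_
    have := stepSize_succ_sq hN0 k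
    nlinarith [sq_nonneg (stepSize N (k + 1))]
  have w0 : totalWeight N 0 ≤ 1 := by rw [totalWeight_zero]; linarith
  have w1 : totalWeight N 1 ≤ 1 := by
    rw [totalWeight_succ, totalWeight_zero]; linarith
  have hmono : ∑ i ∈ range (j + 1), stepSize N i ≤ ∑ i ∈ range 3, stepSize N i :=
    sum_le_sum_of_subset_of_nonneg (range_mono (by omega)) fun i _ _ => stepSize_nonneg N i
  refine hmono.trans ?_
  simp only [sum_range_succ, range_zero, sum_empty]
  linarith [half 0 w0, half 1 w1]

lemma sum_sq_le_one_of_mem_stdSimplex {ι : Type*} [Fintype ι] {p : ι → ℝ}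
    (hp : p ∈ stdSimplex ℝ ι) : ∑ i, p i ^ 2 ≤ 1 := by
  rw [← hp.2]
  refine sum_le_sum fun i _ => ?_
  have h1 : p i ≤ 1 := by
    rw [← hp.2]; exact single_le_sum (fun j _ => hp.1 j) (mem_univ i)
  nlinarith [hp.1 i]

lemma norm_dualVec_le (ha : a ∈ stdSimplex ℝ (Fin n)) (hb : b ∈ stdSimplex ℝ (Fin m)) :
    ‖dualVec a b‖ ≤ 2 := by
  refine (sq_le_sq₀ (norm_nonneg _) (by norm_num)).mp ?_
  rw [norm_sq_blocks]
  have := sum_sq_le_one_of_mem_stdSimplex ha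
  have := sum_sq_le_one_of_mem_stdSimplex hb
  simp only [dualVec_inl, dualVec_inr]
  linarith

lemma regCost_nonneg (hγ : 0 ≤ γ) (hC : ∀ i j, 0 ≤ C i j) {X : Matrix (Fin n) (Fin m) ℝ}
    (hX : ∀ i j, 0 ≤ X i j) : 0 ≤ regCost γ C X :=
  (cost_nonneg hC hX).trans (cost_le_regCost hγ)

/-- The martingale increment factor of a path of the method. -/
def pathNoise (γ : ℝ) (C : Matrix (Fin n) (Fin m) ℝ) (a : Fin n → ℝ) (b : Fin m → ℝ)
    (Xs : Matrix (Fin n) (Fin m) ℝ) (ξ : ℕ → ℝ) (k : ℕ) : ℝ :=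
  CoordinateRun.noise (marginals n m) (blockReflection n m) (vec Xs) γ (stepSize ((n : ℝ) + m))
    (fun k => vec (clvrPrimal γ γ (clvrState γ γ C a b ξ k)))
    (fun k => dualVec (clvrState γ γ C a b ξ k).lam (clvrState γ γ C a b ξ k).mu) k

lemma vec_avg (hγ : γ ≠ 0) (ξ : ℕ → ℝ) (k : ℕ) :
    vec (clvrState γ γ C a b ξ k).avg = (1 / totalWeight ((n : ℝ) + m) k) • ∑ i ∈ range k,
      stepSize ((n : ℝ) + m) (i + 1) • vec (clvrPrimal γ γ (clvrState γ γ C a b ξ i)) := by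
  ext p
  unfold CLVRState.avg
  rw [sumX_eq hγ, (step_weight_eq hγ ξ k).2]
  simp [Matrix.sum_apply]

/-- The cost and the residual of the averaged iterate on every path. -/
theorem cost_add_residual_avg_le (hγ : 0 < γ) (hC : ∀ i j, 0 ≤ C i j)
    (ha : a ∈ stdSimplex ℝ (Fin n)) (hb : b ∈ stdSimplex ℝ (Fin m))
    {Xs : Matrix (Fin n) (Fin m) ℝ} (hXs : Xs ∈ plans a b) {R : ℝ} (hR : 0 ≤ R) (ξ : ℕ → ℝ)
    (k : ℕ) :
    cost C (clvrState γ γ C a b ξ (k + 1)).avg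
      + R * residual a b (clvrState γ γ C a b ξ (k + 1)).avg
    ≤ regCost γ C Xs + 1 / totalWeight ((n : ℝ) + m) (k + 1)
        * (∑ j ∈ range (k + 1), partialWeight (stepRatio ((n : ℝ) + m)) k j
          * (2 * γ + R ^ 2 / γ
            + 1 / γ * ∑ i ∈ range (j + 1), blockSign (ξ i) * pathNoise γ C a b Xs ξ i)
          + 12 * (3 / 2 * regCost γ C Xs)
          + (stepSize ((n : ℝ) + m) (k + 1) + 2 * stepSize ((n : ℝ) + m) 0)
            * (regCost γ C Xs + 2 * R)) := by
  have hN := two_le_add_of_mem_stdSimplex ha hb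
  set N := (n : ℝ) + m with hNdef
  have hN0 : 0 < N := by linarith
  have hrun := coordinateRun hγ hC ha hb hXs ξ
  rw [← hNdef] at hrun
  set x : ℕ → EuclideanSpace ℝ (Fin n × Fin m) :=
    fun k => vec (clvrPrimal γ γ (clvrState γ γ C a b ξ k)) with hx
  have hF0 : 0 ≤ regCost γ C Xs := regCost_nonneg hγ.le hC hXs.1
  set F := regCost γ C Xs with hF
  have hFx : ∀ i, 0 ≤ regObj γ (vec C) (x i) := fun i => by
    rw [hx, regObj_vec]; exact regCost_nonneg hγ.le hC (clvrPrimal_nonneg hγ ξ i)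
  have hFs : regObj γ (vec C) (vec Xs) = F := regObj_vec γ C Xs
  have hlow : ∀ j, j < 3 → -(3 / 2 * F) ≤ ∑ i ∈ range (j + 1),
      stepSize N i * (regObj γ (vec C) (x i) - regObj γ (vec C) (vec Xs)) := by
    intro j hj
    have h1 : ∑ i ∈ range (j + 1), stepSize N i * (-F) ≤ ∑ i ∈ range (j + 1),
        stepSize N i * (regObj γ (vec C) (x i) - regObj γ (vec C) (vec Xs)) := by
      refine sum_le_sum fun i _ => mul_le_mul_of_nonneg_left ?_ (stepSize_nonneg N i)
      rw [hFs]; linarith [hFx i]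
    rw [← sum_mul] at h1
    have := mul_le_mul_of_nonneg_right (sum_stepSize_le_of_lt_three hN hj) hF0
    linarith
  have hmain := reweighted_le (stepRatio_nonneg N) (stepRatio_le hN)
    (fun j hj => stepRatio_succ_le hN hj)
    (fun i => stepSize N i * (regObj γ (vec C) (x i) - regObj γ (vec C) (vec Xs)))
    (fun i => stepSize N i • marginals n m (x i - vec Xs))
    (fun j => 2 * γ + R ^ 2 / γ
      + 1 / γ * ∑ i ∈ range (j + 1), blockSign (ξ i) * pathNoise γ C a b Xs ξ i)
    hR (by positivity) (fun j => hrun.gap_add_residual_le hR j) hlow k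
  simp only [← mul_assoc, smul_smul, stepRatio_mul hN0] at hmain
  set W := ∑ i ∈ range (k + 1), stepSize N (i + 1) with hW
  set A := totalWeight N (k + 1) with hA
  have hApos : 0 < A := totalWeight_pos hN0 _
  -- The weights `a_1, …, a_{k+1}` of the average do not sum to its normaliser `A = 2 a_0 + a_1 + ⋯
  -- + a_k`. The defect biases both the objective and the marginals.
  have hWA : W - A = stepSize N (k + 1) - 2 * stepSize N 0 := by
    have h1 := totalWeight_eq_sum N (k + 1)
    have h2 := sum_range_succ' (stepSize N) (k + 1)
    rw [sum_range_succ] at h2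
    rw [hW, hA]
    linarith
  have hp := stepSize_nonneg N (k + 1)
  have hr := stepSize_nonneg N 0
  have hWle : W ≤ A + (stepSize N (k + 1) + 2 * stepSize N 0) := by linarith
  have habs : |W - A| ≤ stepSize N (k + 1) + 2 * stepSize N 0 := by
    rw [hWA, abs_le]; constructor <;> linarith
  have hvec := vec_avg (C := C) (a := a) (b := b) hγ.ne' ξ (k + 1)
  rw [← hNdef, ← hA] at hvec
  have hcost : A * cost C (clvrState γ γ C a b ξ (k + 1)).avg
      ≤ ∑ i ∈ range (k + 1), stepSize N (i + 1) * (regObj γ (vec C) (x i) - F) + W * F := by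
    rw [← inner_vec_eq_cost, hvec, inner_smul_right, inner_sum, ← mul_assoc,
      mul_one_div_cancel hApos.ne', one_mul, hW, sum_mul, ← sum_add_distrib]
    refine sum_le_sum fun i _ => ?_
    rw [inner_smul_right, ← mul_add, sub_add_cancel]
    refine mul_le_mul_of_nonneg_left ?_ (stepSize_nonneg N _)
    rw [hx, inner_vec_eq_cost, regObj_vec]
    exact cost_le_regCost hγ.le
  have hres : A * residual a b (clvrState γ γ C a b ξ (k + 1)).avg
      ≤ ‖∑ i ∈ range (k + 1), stepSize N (i + 1) • marginals n m (x i - vec Xs)‖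
        + (stepSize N (k + 1) + 2 * stepSize N 0) * 2 := by
    have h1 : marginals n m (vec Xs) = dualVec a b := by rw [marginals_vec, hXs.2.1, hXs.2.2]
    have h2 : A • (marginals n m (vec (clvrState γ γ C a b ξ (k + 1)).avg) - dualVec a b)
        = ∑ i ∈ range (k + 1), stepSize N (i + 1) • marginals n m (x i - vec Xs)
          + (W - A) • dualVec a b := by
      rw [hvec, map_smul, map_sum, smul_sub, smul_smul, mul_one_div_cancel hApos.ne', one_smul,
        sub_smul, hW, sum_smul]
      simp only [map_smul, map_sub, h1, smul_sub, sum_sub_distrib]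
      abel
    have h3 : A * residual a b (clvrState γ γ C a b ξ (k + 1)).avg
        = ‖A • (marginals n m (vec (clvrState γ γ C a b ξ (k + 1)).avg) - dualVec a b)‖ := by
      rw [norm_smul, Real.norm_eq_abs, abs_of_pos hApos, residual_eq_norm]
    rw [h3, h2]
    refine (norm_add_le _ _).trans (add_le_add le_rfl ?_)
    rw [norm_smul, Real.norm_eq_abs]
    exact mul_le_mul habs (norm_dualVec_le ha hb) (norm_nonneg _) (by linarith)
  have hres' := mul_le_mul_of_nonneg_left hres hR
  have hWF := mul_le_mul_of_nonneg_right hWle hF0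
  rw [hFs] at hmain
  refine le_of_mul_le_mul_left ?_ hApos
  rw [mul_add, mul_add, ← mul_assoc A (1 / A), mul_one_div_cancel hApos.ne', one_mul]
  have e : A * (R * residual a b (clvrState γ γ C a b ξ (k + 1)).avg)
      = R * (A * residual a b (clvrState γ γ C a b ξ (k + 1)).avg) := by ring
  rw [e]
  linarith

end Average

/-! ### Functions of finitely many random bits -/

section Bits

open Finset

/-- The value of `g` at a sequence depends only on which of its first `k` terms are below `1/2`. -/
def DependsOnBits {β : Type*} (g : (ℕ → ℝ) → β) (k : ℕ) : Prop :=
  ∀ ξ ξ' : ℕ → ℝ, (∀ i < k, (ξ i < 1 / 2 ↔ ξ' i < 1 / 2)) → g ξ = g ξ'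

lemma DependsOnBits.mono {β : Type*} {g : (ℕ → ℝ) → β} {k l : ℕ} (h : DependsOnBits g k)
    (hkl : k ≤ l) : DependsOnBits g l :=
  fun ξ ξ' hξ => h ξ ξ' fun i hi => hξ i (hi.trans_le hkl)

/-- Only finitely many bit patterns exist, so such a function is a measurable map to a finite
discrete space followed by an arbitrary one; boundedness is automatic. The values `0` and `1` serve
as representatives of the two bits. -/
lemma DependsOnBits.exists_factor {g : (ℕ → ℝ) → ℝ} {k : ℕ} (h : DependsOnBits g k) :
    ∃ f : (range k → ℝ) → ℝ, Measurable f ∧ (∃ M, ∀ v, |f v| ≤ M) ∧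
      ∀ ξ : ℕ → ℝ, g ξ = f fun i => ξ i := by
  let bits : (range k → ℝ) → (range k → Bool) := fun v i => decide (v i < 1 / 2)
  let g' : (range k → Bool) → ℝ := fun s =>
    g fun i => if hi : i ∈ range k then (if s ⟨i, hi⟩ then 0 else 1) else 0
  have hbits : Measurable bits := by
    refine measurable_pi_iff.mpr fun i => measurable_to_bool ?_
    have : (fun v : range k → ℝ => bits v i) ⁻¹' {true} = {v | v i < 1 / 2} := by
      ext v; simp [bits]
    rw [this]
    exact measurableSet_lt (measurable_pi_apply i) measurable_const
  refine ⟨g' ∘ bits, (Measurable.of_discrete (f := g')).comp hbits, ?_, fun ξ => ?_⟩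
  · obtain ⟨M, hM⟩ := (Set.finite_range fun s => |g' s|).bddAbove
    exact ⟨M, fun v => hM ⟨bits v, rfl⟩⟩
  · refine h _ _ fun i hi => ?_
    have hi' : i ∈ range k := mem_range.mpr hi
    simp only [hi', dif_pos, bits, decide_eq_true_eq]
    split_ifs with h1
    · exact ⟨fun _ => by norm_num, fun _ => h1⟩
    · exact ⟨fun h2 => absurd h2 h1, fun h2 => absurd h2 (by norm_num)⟩

lemma measurable_blockSign : Measurable blockSign :=
  Measurable.ite measurableSet_Iio measurable_const measurable_const

lemma integral_blockSign :
    ∫ t, blockSign t ∂((volume : Measure ℝ).restrict (Set.Icc (0 : ℝ) 1)) = 0 := by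
  have h : blockSign = fun t => (Set.Iio (1 / 2 : ℝ)).indicator (fun _ => (2 : ℝ)) t - 1 := by
    funext t
    by_cases ht : t < 1 / 2
    · rw [Set.indicator_of_mem (Set.mem_Iio.mpr ht), blockSign, if_pos ht]; norm_num
    · rw [Set.indicator_of_notMem (by simpa using ht), blockSign, if_neg ht]; norm_num
  have hset : Set.Iio (1 / 2 : ℝ) ∩ Set.Icc 0 1 = Set.Ico 0 (1 / 2) := by
    ext t
    simp only [Set.mem_inter_iff, Set.mem_Iio, Set.mem_Icc, Set.mem_Ico]
    constructor
    · rintro ⟨h1, h2, -⟩; exact ⟨h2, h1⟩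
    · rintro ⟨h1, h2⟩; exact ⟨h2, h1, by linarith⟩
  rw [h, integral_sub ((integrable_const _).indicator measurableSet_Iio) (integrable_const _),
    integral_indicator_const _ measurableSet_Iio, integral_const]
  simp only [measureReal_def, Measure.restrict_apply measurableSet_Iio, hset, Real.volume_Ico,
    Measure.restrict_apply MeasurableSet.univ, Set.univ_inter, Real.volume_Icc]
  norm_num

variable {Ω : Type*} [MeasurableSpace Ω] {P : Measure Ω} {ξ : ℕ → Ω → ℝ}

lemma DependsOnBits.integrable [IsFiniteMeasure P] {g : (ℕ → ℝ) → ℝ} {k : ℕ} (h : DependsOnBits g k)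
    (hξ : ∀ k, Measurable (ξ k)) : Integrable (fun ω => g fun k => ξ k ω) P := by
  obtain ⟨f, hf, ⟨M, hM⟩, hfg⟩ := h.exists_factor
  have : (fun ω => g fun k => ξ k ω) = fun ω => f fun i => ξ i ω := funext fun ω => hfg _
  rw [this]
  refine Integrable.of_bound (hf.comp (measurable_pi_iff.mpr fun i => hξ i)).aestronglyMeasurable
    M (Filter.Eventually.of_forall fun ω => ?_)
  rw [Real.norm_eq_abs]
  exact hM _

/-- A fresh random sign has mean zero given the past. -/
lemma DependsOnBits.integral_blockSign_mul {g : (ℕ → ℝ) → ℝ} {k : ℕ} (h : DependsOnBits g k)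
    (hξ : ∀ k, Measurable (ξ k))
    (hunif : P.map (ξ k) = volume.restrict (Set.Icc (0 : ℝ) 1)) (hind : iIndepFun ξ P) :
    ∫ ω, blockSign (ξ k ω) * g (fun k => ξ k ω) ∂P = 0 := by
  obtain ⟨f, hf, -, hfg⟩ := h.exists_factor
  have hI := hind.indepFun_finset {k} (range k) (by simp) hξ
  have hI' : IndepFun (fun ω => blockSign (ξ k ω)) (fun ω => f fun i => ξ i ω) P :=
    hI.comp (φ := fun v : ({k} : Finset ℕ) → ℝ => blockSign (v ⟨k, mem_singleton_self k⟩))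
      (measurable_blockSign.comp (measurable_pi_apply (⟨k, mem_singleton_self k⟩ : ({k} : Finset ℕ))))
      hf
  have h0 : ∫ ω, blockSign (ξ k ω) ∂P = 0 := by
    rw [← integral_map (hξ k).aemeasurable measurable_blockSign.aestronglyMeasurable, hunif,
      integral_blockSign]
  simp_rw [hfg]
  rw [hI'.integral_fun_mul_eq_mul_integral
    (measurable_blockSign.comp (hξ k)).aestronglyMeasurable
    (hf.comp (measurable_pi_iff.mpr fun i => hξ i)).aestronglyMeasurable, h0, zero_mul]

end Bits

/-! ### The method depends only on the random bits -/

section BitsOfMethod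

open Finset

variable {n m : ℕ} (α γ : ℝ) (C : Matrix (Fin n) (Fin m) ℝ) (a : Fin n → ℝ) (b : Fin m → ℝ)

lemma dependsOnBits_clvrState (k : ℕ) :
    DependsOnBits (fun ξ => clvrState α γ C a b ξ k) k := by
  induction k with
  | zero => exact fun ξ ξ' _ => rfl
  | succ k ih =>
    intro ξ ξ' h
    have h1 := ih ξ ξ' fun i hi => h i (hi.trans (Nat.lt_succ_self k))
    have h2 := h k (Nat.lt_succ_self k)
    simp only [clvrState] at h1 ⊢
    rw [h1]
    simp only [clvrStep, h2]

lemma dependsOnBits_pathNoise (Xs : Matrix (Fin n) (Fin m) ℝ) (k : ℕ) :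
    DependsOnBits (fun ξ => pathNoise γ C a b Xs ξ k) k := by
  intro ξ ξ' h
  have hs : ∀ i ≤ k, clvrState γ γ C a b ξ i = clvrState γ γ C a b ξ' i := fun i hi =>
    (dependsOnBits_clvrState γ γ C a b i).mono hi ξ ξ' h
  simp only [pathNoise, CoordinateRun.noise]
  rw [hs k le_rfl]
  congr 3
  exact sum_congr rfl fun i hi => by rw [hs i (mem_range.mp hi).le]

lemma dependsOnBits_blockSign_mul_pathNoise (Xs : Matrix (Fin n) (Fin m) ℝ) (k : ℕ) :
    DependsOnBits (fun ξ => blockSign (ξ k) * pathNoise γ C a b Xs ξ k) (k + 1) := by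
  intro ξ ξ' h
  have h1 := (dependsOnBits_pathNoise γ C a b Xs k).mono (Nat.le_succ k) ξ ξ' h
  have h2 := h k (Nat.lt_succ_self k)
  simp only at h1 ⊢
  rw [h1]
  simp only [blockSign, h2]

lemma clvrStop_spec (η δ : ℝ) {K : ℕ} (hK : 1 ≤ K) (ξ : ℕ → ℝ) :
    clvrStop α γ η δ K C a b ξ ≤ K ∧
      (stopTest γ η δ C a b (clvrState α γ C a b ξ (clvrStop α γ η δ K C a b ξ)) ∨
        clvrStop α γ η δ K C a b ξ = K) := by
  have hmem : K ∈ {k : ℕ | 1 ≤ k ∧ (stopTest γ η δ C a b (clvrState α γ C a b ξ k) ∨ K ≤ k)} :=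
    ⟨hK, Or.inr le_rfl⟩
  have hle : clvrStop α γ η δ K C a b ξ ≤ K := Nat.sInf_le hmem
  refine ⟨hle, ?_⟩
  rcases (Nat.sInf_mem ⟨K, hmem⟩).2 with h | h
  · exact Or.inl h
  · exact Or.inr (le_antisymm hle h)

lemma dependsOnBits_approxOT (ε δ : ℝ) {K : ℕ} (hK : 1 ≤ K) :
    DependsOnBits (fun ξ => approxOT α ε δ K C a b ξ) K := by
  intro ξ ξ' h
  have hs : ∀ i ≤ K, clvrState α (ε / 3) C a b ξ i = clvrState α (ε / 3) C a b ξ' i := fun i hi =>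
    (dependsOnBits_clvrState α (ε / 3) C a b i).mono hi ξ ξ' h
  have heq : clvrStop α (ε / 3) (ε / 3) δ K C a b ξ
      = clvrStop α (ε / 3) (ε / 3) δ K C a b ξ' := by
    unfold clvrStop
    congr 1
    ext k
    -- From `K` onwards every index belongs to both sets, whatever the later random numbers are.
    rcases le_total k K with hk | hk
    · simp only [Set.mem_ofPred_eq, hs k hk]
    · simp [hk]
  simp only [approxOT]
  rw [heq, hs _ (clvrStop_spec α (ε / 3) C a b (ε / 3) δ hK ξ').1]

end BitsOfMethod

/-! ### Expected cost and the iteration bound -/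

section Conclusion

open Finset

variable {n m : ℕ} {C : Matrix (Fin n) (Fin m) ℝ} {a : Fin n → ℝ} {b : Fin m → ℝ}

/-- Stopping early costs at most `2ε/3` on every path. -/
lemma cost_approxOT_le {ε δ : ℝ} (hε : 0 < ε) (hC : ∀ i j, 0 ≤ C i j)
    (ha : a ∈ stdSimplex ℝ (Fin n)) (hb : b ∈ stdSimplex ℝ (Fin m))
    (hδ : 2 * Real.sqrt ((n : ℝ) + m) * supNorm C * δ ≤ ε / 3) {K : ℕ} (hK : 1 ≤ K)
    {Xs : Matrix (Fin n) (Fin m) ℝ} (hXs : IsOptimalPlan C a b Xs) (ξ : ℕ → ℝ) :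
    cost C (approxOT (ε / 3) ε δ K C a b ξ)
      ≤ 2 * ε / 3 + cost C (roundPlan a b (clvrState (ε / 3) (ε / 3) C a b ξ K).avg) := by
  have hγ : 0 < ε / 3 := by positivity
  have hab : ∑ i, a i = ∑ j, b j := by rw [ha.2, hb.2]
  have hnn := avg_nonneg (C := C) (a := a) (b := b) hγ ξ
  rcases (clvrStop_spec (ε / 3) (ε / 3) C a b (ε / 3) δ hK ξ).2 with h | h
  · have h1 := cost_roundPlan_le hC ha.1 hb.1
      (hnn (clvrStop (ε / 3) (ε / 3) (ε / 3) δ K C a b ξ)) hab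
    -- The optimal cost is at most that of the plan rounded after `K` iterations. The excess of the
    -- accepted plan over it is `ε/3` from the gap, `ε/6` from rounding and `ε/6` from
    -- regularisation.
    have h2 : cost C Xs ≤ cost C (roundPlan a b (clvrState (ε / 3) (ε / 3) C a b ξ K).avg) :=
      hXs.2 (roundPlan_mem_plans ha.1 hb.1 (hnn K) hab)
    have h3 := dual_le_regCost (C := C) hγ hXs.1
      (clvrState (ε / 3) (ε / 3) C a b ξ (clvrStop (ε / 3) (ε / 3) (ε / 3) δ K C a b ξ)).lam
      (clvrState (ε / 3) (ε / 3) C a b ξ (clvrStop (ε / 3) (ε / 3) (ε / 3) δ K C a b ξ)).mu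
    have h4 := regCost_le_cost_add (C := C) hγ.le ha hXs.1
    have h5 := cost_le_regCost (C := C) (X := (clvrState (ε / 3) (ε / 3) C a b ξ
      (clvrStop (ε / 3) (ε / 3) (ε / 3) δ K C a b ξ)).avg) hγ.le
    have h6 := mul_le_mul_of_nonneg_left h.2
      (mul_nonneg (Real.sqrt_nonneg ((n : ℝ) + m)) (supNorm_nonneg C))
    have h7 := h.1
    unfold approxOT
    linarith
  · unfold approxOT
    rw [h]
    linarith

lemma approxOT_mem_plans {ε : ℝ} (hε : 0 < ε) (δ : ℝ) (K : ℕ)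
    (ha : a ∈ stdSimplex ℝ (Fin n)) (hb : b ∈ stdSimplex ℝ (Fin m)) (ξ : ℕ → ℝ) :
    approxOT (ε / 3) ε δ K C a b ξ ∈ plans a b :=
  roundPlan_mem_plans ha.1 hb.1 (avg_nonneg (by positivity) ξ _) (by rw [ha.2, hb.2])

/-- The error terms are small after `10⁴ N M / (3γ)` iterations. -/
lemma error_le {N γ M F : ℝ} (hN : 2 ≤ N) (hγ : 0 < γ) (hM : 3 * γ ≤ M) (hF : F ≤ M + γ / 2)
    {K : ℕ} (hK1 : 1 ≤ K) (hK : 10 ^ 4 * (N * M) ≤ K * (3 * γ)) {w : ℝ} (hw : w ≤ 14) :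
    1 / totalWeight N K * (w * (2 * γ + (Real.sqrt N * M) ^ 2 / γ) + 12 * (3 / 2 * F)
      + (stepSize N K + 2 * stepSize N 0) * (F + 2 * (Real.sqrt N * M))) ≤ γ / 2 := by
  have hN0 : 0 < N := by linarith
  have hM0 : 0 < M := by linarith
  have hApos := totalWeight_pos hN0 K
  have hsq := sq_le_totalWeight hN K
  have hK0 : (1 : ℝ) ≤ K := by exact_mod_cast hK1
  -- Squaring the bound on `K` and using `K² ≤ 1024 N A_K` gives the factor `10⁸ / 9216 > 10⁴`.
  have hA : 10 ^ 4 * (N * M ^ 2) ≤ totalWeight N K * γ ^ 2 := by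
    have h1 : (10 ^ 4 * (N * M)) ^ 2 ≤ (K * (3 * γ)) ^ 2 := by gcongr
    have h2 : (K * (3 * γ)) ^ 2 ≤ 1024 * N * totalWeight N K * (9 * γ ^ 2) := by
      rw [mul_pow]
      calc (K : ℝ) ^ 2 * (3 * γ) ^ 2 ≤ 1024 * N * totalWeight N K * (3 * γ) ^ 2 := by gcongr
        _ = _ := by ring
    refine le_of_mul_le_mul_left ?_ (by positivity : 0 < 9216 * N)
    have : 0 ≤ N ^ 2 * M ^ 2 := by positivity
    nlinarith
  have hA1 : 1 ≤ totalWeight N K := by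
    have h1 : γ ^ 2 ≤ M ^ 2 := by gcongr; linarith
    have h2 : 1 * γ ^ 2 ≤ totalWeight N K * γ ^ 2 := by
      have : M ^ 2 * 1 ≤ M ^ 2 * N := by gcongr; linarith
      nlinarith
    exact le_of_mul_le_mul_right h2 (by positivity)
  have hlast := last_step_mul_le hN hK1 hA1
  set A := totalWeight N K
  have hp : 0 ≤ stepSize N K + 2 * stepSize N 0 := by
    linarith [stepSize_nonneg N K, stepSize_nonneg N 0]
  set p := stepSize N K + 2 * stepSize N 0
  rw [mul_pow, Real.sq_sqrt hN0.le]
  have hsN : Real.sqrt N ≤ N := by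
    rw [Real.sqrt_le_left hN0.le]; nlinarith
  have hFR : F + 2 * (Real.sqrt N * M) ≤ 4 * (N * M) := by
    have : Real.sqrt N * M ≤ N * M := by gcongr
    nlinarith
  have hpK : p * (4 * (N * M)) ≤ A * (γ / 4) := by
    have h1 : p * (10 ^ 4 * (N * M)) ≤ p * (K * (3 * γ)) := by gcongr
    have h2 : p * K * (3 * γ) ≤ 48 * A * (3 * γ) := by gcongr
    have h3 : 0 < A * γ := by positivity
    nlinarith
  have hpF : p * (F + 2 * (Real.sqrt N * M)) ≤ A * (γ / 4) :=
    (mul_le_mul_of_nonneg_left hFR hp).trans hpK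
  have hD0 : 0 ≤ 2 * γ + N * M ^ 2 / γ := by positivity
  have hmain : 14 * (2 * γ + N * M ^ 2 / γ) + 12 * (3 / 2 * F) ≤ A * (γ / 4) := by
    have h1 : N * M ^ 2 / γ * γ = N * M ^ 2 := div_mul_cancel₀ _ hγ.ne'
    refine le_of_mul_le_mul_right ?_ hγ
    have h2 : γ ^ 2 ≤ N * M ^ 2 := by
      have : γ ^ 2 ≤ M ^ 2 := by gcongr; linarith
      nlinarith
    have h3 : M * γ ≤ N * M ^ 2 := by
      have : M * γ ≤ M * M := by gcongr; linarith
      nlinarith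
    have h4 : F * γ ≤ M * γ + γ ^ 2 / 2 := by nlinarith
    nlinarith
  have hwD : w * (2 * γ + N * M ^ 2 / γ) ≤ 14 * (2 * γ + N * M ^ 2 / γ) := by gcongr
  rw [one_div, inv_mul_le_iff₀ hApos]
  linarith

/-- Both factors by which the first term exceeds the second, `√N` and `M / ε`, are at least one. -/
lemma min_rate_eq {N M ε : ℝ} (hN : 2 ≤ N) (hε : 0 < ε) (hM : ε ≤ M) :
    min (N ^ (3 / 2 : ℝ) * M ^ 2 / ε ^ 2) (N * M / ε) = N * M / ε := by
  refine min_eq_right ?_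
  have h1 : N ≤ N ^ (3 / 2 : ℝ) := by
    conv_lhs => rw [← Real.rpow_one N]
    exact Real.rpow_le_rpow_of_exponent_le (by linarith) (by norm_num)
  have h2 : 1 ≤ M / ε := (one_le_div hε).mpr hM
  have hN0 : 0 < N := by linarith
  calc N * M / ε = N * (M / ε) := by ring
    _ ≤ N ^ (3 / 2 : ℝ) * (M / ε) ^ 2 := by
        have : M / ε ≤ (M / ε) ^ 2 := by nlinarith
        gcongr
    _ = _ := by ring

lemma integral_le_affine {Ω : Type*} [MeasurableSpace Ω] {P : Measure Ω} [IsProbabilityMeasure P]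
    {f g : Ω → ℝ} {r : ℝ} (hf : Integrable f P) (hg : Integrable g P)
    (h : ∀ ω, f ω ≤ r + g ω) : ∫ ω, f ω ∂P ≤ r + ∫ ω, g ω ∂P := by
  have h1 := integral_mono hf ((integrable_const r).add hg) h
  have h2 : ∫ ω, (r + g ω) ∂P = r + ∫ ω, g ω ∂P := by
    rw [integral_add (integrable_const r) hg]
    simp
  exact h1.trans_eq h2

/-- The expected cost of the rounded plan. -/
theorem integral_cost_approxOT_le {ε δ : ℝ} (hε : 0 < ε) (hC : ∀ i j, 0 ≤ C i j)
    (ha : a ∈ stdSimplex ℝ (Fin n)) (hb : b ∈ stdSimplex ℝ (Fin m))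
    (hδ : 2 * Real.sqrt ((n : ℝ) + m) * supNorm C * δ ≤ ε / 3) {K : ℕ} (hK : 1 ≤ K)
    (hεC : ε ≤ supNorm C) (hKc : 10 ^ 4 * (((n : ℝ) + m) * supNorm C / ε) ≤ K)
    {Xs : Matrix (Fin n) (Fin m) ℝ} (hXs : IsOptimalPlan C a b Xs)
    {Ω : Type*} [MeasurableSpace Ω] {P : Measure Ω} [IsProbabilityMeasure P] {ξ : ℕ → Ω → ℝ}
    (hξ : ∀ k, Measurable (ξ k))
    (hunif : ∀ k, P.map (ξ k) = volume.restrict (Set.Icc (0 : ℝ) 1)) (hind : iIndepFun ξ P) :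
    ∫ ω, cost C (approxOT (ε / 3) ε δ K C a b fun k => ξ k ω) ∂P ≤ cost C Xs + ε := by
  have hN := two_le_add_of_mem_stdSimplex ha hb
  have hγ : 0 < ε / 3 := by positivity
  have hab : ∑ i, a i = ∑ j, b j := by rw [ha.2, hb.2]
  obtain ⟨k, rfl⟩ := Nat.exists_eq_succ_of_ne_zero (by omega : K ≠ 0)
  simp only [Nat.succ_eq_add_one] at *
  set γ := ε / 3 with hγε
  -- Exactly the price of rounding per unit of residual, so that the pathwise bound controls the
  -- rounded cost.
  set R := Real.sqrt ((n : ℝ) + m) * supNorm C with hR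
  have hR0 : 0 ≤ R := mul_nonneg (Real.sqrt_nonneg _) (supNorm_nonneg C)
  set F := regCost γ C Xs with hF
  set w := partialWeight (stepRatio ((n : ℝ) + m)) k with hw
  set A := totalWeight ((n : ℝ) + m) (k + 1) with hA
  set L := 12 * (3 / 2 * F) + (stepSize ((n : ℝ) + m) (k + 1) + 2 * stepSize ((n : ℝ) + m) 0)
    * (F + 2 * R) with hL
  set D := 2 * γ + R ^ 2 / γ with hD
  have hpath : ∀ ω, cost C (approxOT γ ε δ (k + 1) C a b fun k => ξ k ω)
      ≤ 2 * ε / 3 + (F + 1 / A * (∑ j ∈ range (k + 1), w j * (D + 1 / γ * ∑ i ∈ range (j + 1),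
          blockSign (ξ i ω) * pathNoise γ C a b Xs (fun k => ξ k ω) i) + L)) := by
    intro ω
    have h1 := cost_approxOT_le hε hC ha hb hδ hK hXs fun k => ξ k ω
    have h2 := cost_roundPlan_le hC ha.1 hb.1
      (avg_nonneg (C := C) (a := a) (b := b) hγ (fun k => ξ k ω) (k + 1)) hab
    have h3 := cost_add_residual_avg_le hγ hC ha hb hXs.1 hR0 (fun k => ξ k ω) k
    rw [add_assoc] at h3
    exact h1.trans (add_le_add le_rfl (h2.trans h3))
  have hterm : ∀ i, Integrable (fun ω => blockSign (ξ i ω)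
      * pathNoise γ C a b Xs (fun k => ξ k ω) i) P := fun i =>
    (dependsOnBits_blockSign_mul_pathNoise γ C a b Xs i).integrable hξ
  have hinner : ∀ j, Integrable (fun ω => D + 1 / γ * ∑ i ∈ range (j + 1),
      blockSign (ξ i ω) * pathNoise γ C a b Xs (fun k => ξ k ω) i) P := fun j =>
    (integrable_const _).add ((integrable_finsetSum _ fun i _ => hterm i).const_mul _)
  have hmean : ∀ j, ∫ ω, (D + 1 / γ * ∑ i ∈ range (j + 1),
      blockSign (ξ i ω) * pathNoise γ C a b Xs (fun k => ξ k ω) i) ∂P = D := by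
    intro j
    rw [integral_add (integrable_const _)
      ((integrable_finsetSum _ fun i _ => hterm i).const_mul _), integral_const_mul,
      integral_finsetSum _ fun i _ => hterm i, sum_eq_zero fun i _ =>
        (dependsOnBits_pathNoise γ C a b Xs i).integral_blockSign_mul hξ (hunif i) hind]
    simp
  have hsumI : Integrable (fun ω => ∑ j ∈ range (k + 1), w j * (D + 1 / γ *
      ∑ i ∈ range (j + 1), blockSign (ξ i ω) * pathNoise γ C a b Xs (fun k => ξ k ω) i)) P :=
    integrable_finsetSum _ fun j _ => (hinner j).const_mul _
  have hcostI : Integrable (fun ω => cost C (approxOT γ ε δ (k + 1) C a b fun k => ξ k ω)) P := by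
    refine DependsOnBits.integrable (g := fun ξ => cost C (approxOT γ ε δ (k + 1) C a b ξ))
      (k := k + 1) (fun η η' h => ?_) hξ
    exact congrArg (cost C) (dependsOnBits_approxOT γ C a b ε δ hK η η' h)
  have hbound := integral_le_affine hcostI ((hsumI.add (integrable_const L)).const_mul (1 / A))
    fun ω => (hpath ω).trans_eq (add_assoc _ _ _).symm
  have hval : ∫ ω, 1 / A * (∑ j ∈ range (k + 1), w j * (D + 1 / γ * ∑ i ∈ range (j + 1),
      blockSign (ξ i ω) * pathNoise γ C a b Xs (fun k => ξ k ω) i) + L) ∂P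
      = 1 / A * ((∑ j ∈ range (k + 1), w j) * D + L) := by
    rw [integral_const_mul, integral_add hsumI (integrable_const _),
      integral_finsetSum _ fun j _ => (hinner j).const_mul _]
    simp only [integral_const_mul, hmean, integral_const, probReal_univ, one_smul, sum_mul]
  have hFle : F ≤ cost C Xs + γ / 2 := regCost_le_cost_add hγ.le ha hXs.1
  have hKγ : 10 ^ 4 * (((n : ℝ) + m) * supNorm C) ≤ ((k + 1 : ℕ) : ℝ) * (3 * γ) := by
    rw [mul_div_assoc', div_le_iff₀ hε] at hKc
    rw [hγε]
    linarith
  have herr := error_le (F := F) hN hγ (by rw [hγε]; linarith)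
    (hFle.trans (by linarith [cost_plan_le (C := C) ha hXs.1])) hK hKγ
    (sum_partialWeight_le (stepRatio_nonneg _) (stepRatio_le hN)
      (fun j hj => stepRatio_succ_le hN hj) k)
  rw [add_assoc] at herr
  have herr' : 1 / A * ((∑ j ∈ range (k + 1), w j) * D + L) ≤ γ / 2 := herr
  -- The budget in units of `γ = ε/3`: `2γ` for early stopping, `γ/2` for regularisation and `γ/2`
  -- for the error after `K` iterations.
  refine hbound.trans ((add_le_add le_rfl (hval.le.trans herr')).trans ?_)
  linarith

end Conclusion

end EuclideanOT

end

theorem theorem8 :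
    ∃ c : ℝ, 0 < c ∧
      ∀ (n m : ℕ) (C : Matrix (Fin n) (Fin m) ℝ) (ε : ℝ), (∀ i j, 0 ≤ C i j) → 0 < ε →
        ∃ α : ℝ, 0 < α ∧
          ∀ (a : Fin n → ℝ) (b : Fin m → ℝ), a ∈ stdSimplex ℝ (Fin n) → b ∈ stdSimplex ℝ (Fin m) →
          ∀ δ : ℝ, 2 * Real.sqrt ((n : ℝ) + m) * EuclideanOT.supNorm C * δ ≤ ε / 3 →
          ∀ K : ℕ, 1 ≤ K →
            c * min (((n : ℝ) + m) ^ (3 / 2 : ℝ) * EuclideanOT.supNorm C ^ 2 / ε ^ 2)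
                (((n : ℝ) + m) * EuclideanOT.supNorm C / ε) ≤ (K : ℝ) →
          ∀ (Ω : Type*) [MeasurableSpace Ω] (P : Measure Ω) [IsProbabilityMeasure P]
            (ξ : ℕ → Ω → ℝ), (∀ k, Measurable (ξ k)) →
            (∀ k, P.map (ξ k) = volume.restrict (Set.Icc (0 : ℝ) 1)) → iIndepFun ξ P →
            (∀ ω, EuclideanOT.approxOT α ε δ K C a b (fun k => ξ k ω) ∈ EuclideanOT.plans a b) ∧
            Integrable (fun ω => EuclideanOT.cost C
              (EuclideanOT.approxOT α ε δ K C a b (fun k => ξ k ω))) P ∧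
            ∃ Xstar, EuclideanOT.IsOptimalPlan C a b Xstar ∧
              (∫ ω, EuclideanOT.cost C
                (EuclideanOT.approxOT α ε δ K C a b (fun k => ξ k ω)) ∂P) - ε
                ≤ EuclideanOT.cost C Xstar := by
  refine ⟨10 ^ 4, by norm_num, fun n m C ε hC hε => ⟨ε / 3, by positivity, ?_⟩⟩
  intro a b ha hb δ hδ K hK hKc Ω _ P _ ξ hξ hunif hind
  have hmem : ∀ ω, EuclideanOT.approxOT (ε / 3) ε δ K C a b (fun k => ξ k ω)
      ∈ EuclideanOT.plans a b := fun ω => EuclideanOT.approxOT_mem_plans hε δ K ha hb _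
  have hint : Integrable (fun ω => EuclideanOT.cost C
      (EuclideanOT.approxOT (ε / 3) ε δ K C a b (fun k => ξ k ω))) P :=
    EuclideanOT.DependsOnBits.integrable (k := K)
      (g := fun ξ => EuclideanOT.cost C (EuclideanOT.approxOT (ε / 3) ε δ K C a b ξ))
      (fun η η' h => congrArg (EuclideanOT.cost C)
        (EuclideanOT.dependsOnBits_approxOT (ε / 3) C a b ε δ hK η η' h)) hξ
  obtain ⟨Xstar, hX⟩ := EuclideanOT.exists_isOptimalPlan C ha hb
  refine ⟨hmem, hint, Xstar, hX, ?_⟩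
  rw [sub_le_iff_le_add]
  -- For `ε` above the largest cost the iteration bound is irrelevant: the cost of any plan is at
  -- most `ε`, and the optimal cost is nonnegative.
  rcases le_total ε (EuclideanOT.supNorm C) with h | h
  · rw [EuclideanOT.min_rate_eq (EuclideanOT.two_le_add_of_mem_stdSimplex ha hb) hε h] at hKc
    exact EuclideanOT.integral_cost_approxOT_le hε hC ha hb hδ hK h hKc hX hξ hunif hind
  · have h1 := integral_mono hint (integrable_const ε)
      fun ω => (EuclideanOT.cost_plan_le (C := C) ha (hmem ω)).trans h
    rw [integral_const, probReal_univ, one_smul] at h1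
    linarith [EuclideanOT.cost_nonneg hC hX.1.1]
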